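/- **Setting.** Let $\Omega\subset\mathbb R^3$ be open, with coordinates $(x,y,t)$, and let $\mathbb C^+,\mathbb C^-$ denote the closed upper and lower half planes of the spectral parameter $\lambda$. Let $R=(R_1,R_2):\mathbb C^2\to\mathbb C^2$ be complex differentiable, with Jacobian matrix $J_{mn}=\partial R_m/\partial\xi_n$. For a complex-valued function $u(x,y,t)$ put $$L_1=\partial_y-\lambda\partial_x+2u_x\lambda\partial_\lambda,\qquad L_2=\partial_t+\left(\tfrac12\lambda^2+u\lambda\right)\partial_x-(u_x\lambda+u_y+2uu_x)\lambda\partial_\lambda .$$ $L_1$ and $L_2$ act componentwise on vector functions. **The Riemann–Hilbert problem.** A *solution* on $\Omega$ consists of functions $u$, $v=\partial_x^{-1}u$ (a smooth $v:\Omega\to\mathbb C$ with $v_x=u$; we put $\partial_x^{-1}u_y:=v_y$) and $\pi^\pm=(\pi_1^\pm,\pi_2^\pm):\Omega\times\mathbb C^\pm\to\mathbb C^2$, where $\pi^\pm$ are smooth up to the boundary and holomorphic in $\lambda$ in the interior of $\mathbb C^\pm$, such that $$\pi^+(\lambda)=R(\pi^-(\lambda)),\qquad\lambda\in\mathbb R,$$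 $$\pi^\pm(\lambda)=\begin{pmatrix}\lambda+2u\\[2pt] -\frac t2\lambda^2-2ut\lambda+y\lambda+x+2uy-2u^2t-2t\,\partial_x^{-1}u_y\end{pmatrix}+O(\lambda^{-1}),\qquad\lambda\to\infty,$$ and such that $u$ is recovered from the asymptotics by $$\partial_x^{-1}u=\lim_{\lambda\to\infty}\frac\lambda2\left(\pi_2^\pm-y\,\pi_1^\pm+\frac t2(\pi_1^\pm)^2-x\right).$$ Here $O(\lambda^{-1})$ denotes $\lambda^{-1}g(x,y,t,\lambda^{-1})$ with $g(x,y,t,\mu)$ smooth up to and including $\mu=0$, so that the remainder has an asymptotic expansion in powers of $\lambda^{-1}$ which may be differentiated term by term. **Theorem.** Let $(u,v,\pi^+,\pi^-)$ be a solution on $\Omega$. 1. $L_j\pi^+(\lambda)=J(\pi^-(\lambda))\,L_j\pi^-(\lambda)$ for $\lambda\in\mathbb R$, $j=1,2$. 2. Assume that the linearised problem has only the zero solution: for every $(x,y,t)\in\Omega$, if $\psi^\pm:\mathbb C^\pm\to\mathbb C^2$ are continuous, holomorphic in the interior, tend to $0$ as $\lambda\to\infty$ and satisfy $\psi^+=J(\pi^-)\psi^-$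 on $\mathbb R$, then $\psi^\pm=0$. Then $L_1\pi^\pm=L_2\pi^\pm=0$ on $\Omega\times\mathbb C^\pm$, i.e. $\pi^\pm$ are common eigenfunctions of the Lax pair, and $u$ solves on $\Omega$ the equation $$u_{xt}+\tfrac12u_{yy}+\tfrac12(u^2)_{xy}=0 .$$ 3. Assume that any two solutions of the nonlinear problem on $\Omega$ (for the given $R$, with $u$, $v$, $\pi^\pm$ unknown) have the same $\pi^\pm$, and that $R(\overline{R(\bar\xi)})=\xi$ for all $\xi\in\mathbb C^2$. Then $u$ is real on $\Omega$. -/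

import Mathlib

open scoped ContDiff Topology Matrix

noncomputable section

namespace NRH

/-- The closed upper half of the complex plane of the spectral parameter. -/
def upper : Set ℂ := {z | 0 ≤ z.im}

/-- The closed lower half of the complex plane of the spectral parameter. -/
def lower : Set ℂ := {z | z.im ≤ 0}

/-- Scalar functions of the real variables `x, y, t`. -/
abbrev Field := ℝ → ℝ → ℝ → ℂ

/-- Vector functions `π(x, y, t; z)` with two components; `z` is the spectral parameter
(called `λ` in the literature). -/
abbrev Wave := ℝ → ℝ → ℝ → ℂ → Fin 2 → ℂ

def dx (u : Field) : Field := fun x y t => deriv (fun s => u s y t) x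
def dy (u : Field) : Field := fun x y t => deriv (fun s => u x s t) y
def dt (u : Field) : Field := fun x y t => deriv (fun s => u x y s) t

/-- The equation `u_xt + (1/2) u_yy + (1/2) (u ^ 2)_xy = 0` at the point `(x, y, t)`. -/
def SolvesAt (u : Field) (x y t : ℝ) : Prop :=
  dt (dx u) x y t + 1 / 2 * dy (dy u) x y t
    + 1 / 2 * dy (dx (fun x y t => u x y t ^ 2)) x y t = 0

/-- `L₁ = ∂_y - λ ∂_x + 2 u_x λ ∂_λ`, applied to each component of a vector function that is
defined for `λ` in the closed half plane `H`. On the real line `∂_λ` is the derivative taken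
within `H`; inside `H` it is the complex derivative. -/
def lax₁ (u : Field) (H : Set ℂ) (π : Wave) : Wave := fun x y t z i =>
  deriv (fun s => π x s t z i) y
    - z * deriv (fun s => π s y t z i) x
    + 2 * dx u x y t * z * derivWithin (fun w => π x y t w i) H z

/-- `L₂ = ∂_t + (λ²/2 + u λ) ∂_x - (u_x λ + u_y + 2 u u_x) λ ∂_λ`, with the same convention. -/
def lax₂ (u : Field) (H : Set ℂ) (π : Wave) : Wave := fun x y t z i =>
  deriv (fun s => π x y s z i) t
    + (1 / 2 * z ^ 2 + u x y t * z) * deriv (fun s => π s y t z i) x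
    - (dx u x y t * z + dy u x y t + 2 * u x y t * dx u x y t) * z
        * derivWithin (fun w => π x y t w i) H z

/-- The Jacobian matrix `J_{mn} = ∂R_m/∂ξ_n`. -/
def jacobian (R : (Fin 2 → ℂ) → (Fin 2 → ℂ)) (ξ : Fin 2 → ℂ) : Matrix (Fin 2) (Fin 2) ℂ :=
  Matrix.of fun m n => fderiv ℂ R ξ (Pi.single n 1) m

/-- The remainder class `O(λ⁻¹)`: `r = λ⁻¹ g(x, y, t, λ⁻¹)`, where `g(x, y, t, μ)` is smooth up
to and including `μ = 0` (and `μ = 1/λ` runs through the half plane conjugate to `H`). Thus `r`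
has an asymptotic expansion in negative powers of `λ` that may be differentiated term by term. -/
def IsBigOInv (Ω : Set (ℝ × ℝ × ℝ)) (H : Set ℂ) (r : ℝ → ℝ → ℝ → ℂ → ℂ) : Prop :=
  ∃ g : ℝ × ℝ × ℝ × ℂ → ℂ,
    ContDiffOn ℝ ∞ g {q | (q.1, q.2.1, q.2.2.1) ∈ Ω ∧ star q.2.2.2 ∈ H} ∧
    ∀ x y t, (x, y, t) ∈ Ω → ∀ z ∈ H, z ≠ 0 → r x y t z = z⁻¹ * g (x, y, t, z⁻¹)

/-- `π` is smooth on `Ω × H`, holomorphic in `λ` inside the half plane `H`, and normalised at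
`λ → ∞` with coefficients given by `u` and its antiderivative `v = ∂_x⁻¹ u`
(so `∂_x⁻¹ u_y` is `∂_y v`). -/
structure IsNormalized (Ω : Set (ℝ × ℝ × ℝ)) (H : Set ℂ) (u v : Field) (π : Wave) : Prop where
  smooth : ∀ i, ContDiffOn ℝ ∞ (fun q : ℝ × ℝ × ℝ × ℂ => π q.1 q.2.1 q.2.2.1 q.2.2.2 i)
    {q | (q.1, q.2.1, q.2.2.1) ∈ Ω ∧ q.2.2.2 ∈ H}
  holomorphic : ∀ x y t, (x, y, t) ∈ Ω → ∀ i,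
    DifferentiableOn ℂ (fun z => π x y t z i) (interior H)
  expansion₁ : IsBigOInv Ω H fun x y t z => π x y t z 0 - (z + 2 * u x y t)
  expansion₂ : IsBigOInv Ω H fun x y t z => π x y t z 1 -
    (-(t / 2) * z ^ 2 - 2 * u x y t * t * z + y * z + x + 2 * u x y t * y
      - 2 * u x y t ^ 2 * t - 2 * t * dy v x y t)
  recovery : ∀ x y t, (x, y, t) ∈ Ω →
    Filter.Tendsto
      (fun z : ℂ => z / 2 *
        (π x y t z 1 - y * π x y t z 0 + t / 2 * π x y t z 0 ^ 2 - x))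
      (Bornology.cobounded ℂ ⊓ Filter.principal H) (𝓝 (v x y t))

/-- A solution of the nonlinear Riemann-Hilbert problem `π⁺ = R(π⁻)` on the real line, for
`(x, y, t)` in `Ω`. -/
structure IsSolution (Ω : Set (ℝ × ℝ × ℝ)) (R : (Fin 2 → ℂ) → (Fin 2 → ℂ))
    (u v : Field) (πp πm : Wave) : Prop where
  smooth_v : ContDiffOn ℝ ∞ (fun p : ℝ × ℝ × ℝ => v p.1 p.2.1 p.2.2) Ω
  antiderivative : ∀ x y t, (x, y, t) ∈ Ω → HasDerivAt (fun s => v s y t) (u x y t) x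
  plus : IsNormalized Ω upper u v πp
  minus : IsNormalized Ω lower u v πm
  jump : ∀ x y t, (x, y, t) ∈ Ω → ∀ l : ℝ, πp x y t l = R (πm x y t l)

/-- The nonlinear problem (with unknowns `u`, `v = ∂_x⁻¹ u`, `π⁺`, `π⁻`) has at most one
solution. -/
def SolutionUnique (Ω : Set (ℝ × ℝ × ℝ)) (R : (Fin 2 → ℂ) → (Fin 2 → ℂ)) : Prop :=
  ∀ (u v u' v' : Field) (πp πm πp' πm' : Wave),
    IsSolution Ω R u v πp πm → IsSolution Ω R u' v' πp' πm' →
    ∀ x y t, (x, y, t) ∈ Ω →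
      (∀ z ∈ upper, πp x y t z = πp' x y t z) ∧ (∀ z ∈ lower, πm x y t z = πm' x y t z)

/-- The linearised problem `ψ⁺ = J(π⁻) ψ⁻` on the real line, `ψ^± → 0` at infinity, has only the
zero solution, for each `(x, y, t)` in `Ω`. -/
def LinearizedUnique (Ω : Set (ℝ × ℝ × ℝ)) (R : (Fin 2 → ℂ) → (Fin 2 → ℂ)) (πm : Wave) : Prop :=
  ∀ x y t, (x, y, t) ∈ Ω → ∀ ψp ψm : ℂ → Fin 2 → ℂ,
    ContinuousOn ψp upper → DifferentiableOn ℂ ψp (interior upper) →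
    ContinuousOn ψm lower → DifferentiableOn ℂ ψm (interior lower) →
    (∀ l : ℝ, ψp l = jacobian R (πm x y t l) *ᵥ ψm l) →
    Filter.Tendsto ψp (Bornology.cobounded ℂ ⊓ Filter.principal upper) (𝓝 0) →
    Filter.Tendsto ψm (Bornology.cobounded ℂ ⊓ Filter.principal lower) (𝓝 0) →
    (∀ z ∈ upper, ψp z = 0) ∧ (∀ z ∈ lower, ψm z = 0)

end NRH

end

/-! Every derivation in `x, y, t, λ` turns the jump `π⁺ = R(π⁻)` into the linear jump `ψ⁺ = J(π⁻)
ψ⁻`. Its solutions (`LinSol`) may be added and multiplied by entire functions of `λ`, so `L₁π` and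
`L₂π` are solutions too; this is the first claim.

For the second claim uniqueness needs decay at infinity. Put `μ = 1/λ` and `π₁ = λ + 2u + μ g`, `π₂
= ρ + yπ₁ - tπ₁²/2 + x`. Normalisation and recovery give `g = 2v_y`, `ρ = 0`, `ρ_μ = 2v` at `μ = 0`
(`IsNormalized.exists_expansion`). The `defect` of a derivative of `π` is the part of its second
component not forced by its first; it involves only `ρ` and explicit terms. For `X = L₁π` one finds
`λX₁ → C` and defect `→ 0`. As `π₁ ~ λ`, this makes `X₂` tend to `-tC` and not to `0`, so uniqueness
does not apply at once.

The remedy (`eq_zero_of_small`) uses two known solutions, `α = π_λ` and `β = π_x - 2u_x π_λ`, where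
`β → (0, 1 - tc)` with `c = 2u_y`. Cramer's rule on the real axis shows that `C` is the same in both
half planes (`eq_of_small`). Then `(1 - tc)X + tCβ` tends to `0`, hence vanishes; its first
component is asymptotic to `C/λ`, so `C = 0`, and now `X → 0` and `X = 0`.

For `L₂` the first component has the limit `E = 2u_t + v_yy + 2uu_y` (`residue`), so the same
argument only yields `L₂π = Eπ_λ`. Commuting `L₁` with `L₂ - E∂_λ` (`IsNormalized.commutator`) gives
a relation `-Eπ_x + (aλ + b)π_λ = 0`, whose defect at infinity is `-E`. So `E = 0`, and the
remaining multiple of `λπ_λ` is the equation, because `π_λ` has first component tending to `1`.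

For the third claim, Schwarz reflection exchanges the half planes and, by the condition on `R`,
produces another solution with field `ū`. Uniqueness of `π⁺` forces `u = ū`. -/

noncomputable section

namespace NRH

/-! ### Half planes and inversion of the spectral parameter -/

/-- The closed upper or lower half plane. -/
def IsHalfPlane (H : Set ℂ) : Prop := H = upper ∨ H = lower

theorem isHalfPlane_upper : IsHalfPlane upper := Or.inl rfl

theorem isHalfPlane_lower : IsHalfPlane lower := Or.inr rfl

/-- The half plane conjugate to `H`. -/
def conjSet (H : Set ℂ) : Set ℂ := {z | star z ∈ H}

theorem conjSet_upper : conjSet upper = lower := by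
  ext z; simp [conjSet, upper, lower]

theorem conjSet_lower : conjSet lower = upper := by
  ext z; simp [conjSet, upper, lower]

theorem interior_upper : interior upper = {z : ℂ | 0 < z.im} := by
  simp [upper]

theorem interior_lower : interior lower = {z : ℂ | z.im < 0} := by
  simp [lower]

namespace IsHalfPlane

variable {H : Set ℂ}

theorem conj (h : IsHalfPlane H) : IsHalfPlane (conjSet H) := by
  rcases h with rfl | rfl
  · exact Or.inr conjSet_upper
  · exact Or.inl conjSet_lower

theorem convex (h : IsHalfPlane H) : Convex ℝ H := by
  rcases h with rfl | rfl
  · exact convex_halfSpace_im_ge 0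
  · exact convex_halfSpace_im_le 0

theorem nonempty_interior (h : IsHalfPlane H) : (interior H).Nonempty := by
  rcases h with rfl | rfl
  · exact ⟨Complex.I, by simp [interior_upper]⟩
  · exact ⟨-Complex.I, by simp [interior_lower]⟩

theorem subset_closure_interior (h : IsHalfPlane H) : H ⊆ closure (interior H) := by
  rw [h.convex.closure_interior_eq_closure_of_nonempty_interior h.nonempty_interior]
  exact subset_closure

theorem uniqueDiffOn_real (h : IsHalfPlane H) : UniqueDiffOn ℝ H :=
  uniqueDiffOn_convex h.convex h.nonempty_interior

theorem ofReal_mem (h : IsHalfPlane H) (l : ℝ) : (l : ℂ) ∈ H := by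
  rcases h with rfl | rfl <;> simp [upper, lower]

theorem zero_mem (h : IsHalfPlane H) : (0 : ℂ) ∈ H := by
  simpa using h.ofReal_mem 0

theorem uniqueDiffOn (h : IsHalfPlane H) : UniqueDiffOn ℂ H :=
  h.uniqueDiffOn_real.of_real

theorem inv_mem (h : IsHalfPlane H) {z : ℂ} (hz : z ∈ H) : z⁻¹ ∈ conjSet H := by
  rcases h with rfl | rfl
  · simp only [conjSet, upper, Set.mem_ofPred_eq, Complex.star_def, Complex.conj_im,
      Complex.inv_im] at *
    rw [neg_div, neg_neg]; exact div_nonneg hz (Complex.normSq_nonneg z)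
  · simp only [conjSet, lower, Set.mem_ofPred_eq, Complex.star_def, Complex.conj_im,
      Complex.inv_im] at *
    rw [neg_div, neg_neg]; exact div_nonpos_of_nonpos_of_nonneg hz (Complex.normSq_nonneg z)

theorem inv_mem_interior (h : IsHalfPlane H) {z : ℂ} (hz : z ∈ interior (conjSet H)) :
    z ≠ 0 ∧ z⁻¹ ∈ interior H := by
  have key : z.im ≠ 0 → z ≠ 0 ∧ 0 < Complex.normSq z := fun h0 => by
    have : z ≠ 0 := by rintro rfl; simp at h0
    exact ⟨this, Complex.normSq_pos.2 this⟩
  rcases h with rfl | rfl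
  · rw [conjSet_upper, interior_lower] at hz
    obtain ⟨h0, h1⟩ := key (ne_of_lt hz)
    refine ⟨h0, ?_⟩
    rw [interior_upper]
    simp only [Set.mem_ofPred_eq, Complex.inv_im] at *
    exact div_pos (by linarith) h1
  · rw [conjSet_lower, interior_upper] at hz
    obtain ⟨h0, h1⟩ := key (ne_of_gt hz)
    refine ⟨h0, ?_⟩
    rw [interior_lower]
    simp only [Set.mem_ofPred_eq, Complex.inv_im] at *
    exact div_neg_of_neg_of_pos (by linarith) h1

end IsHalfPlane

/-! ### Calculus up to the boundary on `Ω × H` -/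

/-- The domain `Ω × H`. -/
def dom (Ω : Set (ℝ × ℝ × ℝ)) (H : Set ℂ) : Set (ℝ × ℝ × ℝ × ℂ) :=
  {q | (q.1, q.2.1, q.2.2.1) ∈ Ω ∧ q.2.2.2 ∈ H}

/-- Directional derivative within `Ω × H`. -/
def pd (Ω : Set (ℝ × ℝ × ℝ)) (H : Set ℂ) (e : ℝ × ℝ × ℝ × ℂ) (F : ℝ × ℝ × ℝ × ℂ → ℂ) :
    ℝ × ℝ × ℝ × ℂ → ℂ :=
  fun q => fderivWithin ℝ F (dom Ω H) q e

abbrev ex : ℝ × ℝ × ℝ × ℂ := (1, 0, 0, 0)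
abbrev ey : ℝ × ℝ × ℝ × ℂ := (0, 1, 0, 0)
abbrev et : ℝ × ℝ × ℝ × ℂ := (0, 0, 1, 0)
abbrev ez : ℝ × ℝ × ℝ × ℂ := (0, 0, 0, 1)

/-- Functions that are smooth on `Ω × H` and holomorphic in the last variable inside `H`. -/
structure Nice (Ω : Set (ℝ × ℝ × ℝ)) (H : Set ℂ) (F : ℝ × ℝ × ℝ × ℂ → ℂ) : Prop where
  smooth : ContDiffOn ℝ ∞ F (dom Ω H)
  hol : ∀ x y t, (x, y, t) ∈ Ω → DifferentiableOn ℂ (fun z => F (x, y, t, z)) (interior H)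

section calculus

variable {Ω : Set (ℝ × ℝ × ℝ)} {H : Set ℂ} {F : ℝ × ℝ × ℝ × ℂ → ℂ}

theorem isOpen_base (hΩ : IsOpen Ω) :
    IsOpen {q : ℝ × ℝ × ℝ × ℂ | (q.1, q.2.1, q.2.2.1) ∈ Ω} :=
  hΩ.preimage (f := fun q : ℝ × ℝ × ℝ × ℂ => (q.1, q.2.1, q.2.2.1)) (by fun_prop)

theorem dom_eq : dom Ω H = ((Set.univ ×ˢ Set.univ ×ˢ Set.univ ×ˢ H) ∩
    {q : ℝ × ℝ × ℝ × ℂ | (q.1, q.2.1, q.2.2.1) ∈ Ω}) := by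
  ext q; simp [dom, and_comm]

theorem uniqueDiffOn_dom (hΩ : IsOpen Ω) (hH : IsHalfPlane H) : UniqueDiffOn ℝ (dom Ω H) := by
  rw [dom_eq]
  refine UniqueDiffOn.inter ?_ (isOpen_base hΩ)
  exact uniqueDiffOn_univ.prod (uniqueDiffOn_univ.prod (uniqueDiffOn_univ.prod
    hH.uniqueDiffOn_real))

/-- Needed for the symmetry of second derivatives at boundary points, in particular at real `λ` and
at `μ = 0`. -/
theorem dom_subset_closure_interior (hΩ : IsOpen Ω) (hH : IsHalfPlane H) :
    dom Ω H ⊆ closure (interior (dom Ω H)) := by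
  have h1 : interior (dom Ω H) = ((Set.univ ×ˢ Set.univ ×ˢ Set.univ ×ˢ interior H) ∩
    {q : ℝ × ℝ × ℝ × ℂ | (q.1, q.2.1, q.2.2.1) ∈ Ω}) := by
    rw [dom_eq, interior_inter, (isOpen_base hΩ).interior_eq]
    simp [interior_prod_eq]
  rw [h1, dom_eq]
  rintro q ⟨hq1, hq2⟩
  refine (isOpen_base hΩ).closure_inter ⟨?_, hq2⟩
  simp only [closure_prod_eq, closure_univ]
  exact ⟨trivial, trivial, trivial, hH.subset_closure_interior hq1.2.2.2⟩

theorem pd_smooth (hΩ : IsOpen Ω) (hH : IsHalfPlane H) (hF : ContDiffOn ℝ ∞ F (dom Ω H))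
    (e : ℝ × ℝ × ℝ × ℂ) : ContDiffOn ℝ ∞ (pd Ω H e F) (dom Ω H) :=
  (hF.fderivWithin (uniqueDiffOn_dom hΩ hH) (by simp)).clm_apply contDiffOn_const

theorem hasFDerivWithinAt_dom (hF : ContDiffOn ℝ ∞ F (dom Ω H)) {q : ℝ × ℝ × ℝ × ℂ}
    (hq : q ∈ dom Ω H) :
    HasFDerivWithinAt F (fderivWithin ℝ F (dom Ω H) q) (dom Ω H) q :=
  (hF.differentiableOn (by simp) q hq).hasFDerivWithinAt

theorem pd_comm (hΩ : IsOpen Ω) (hH : IsHalfPlane H) (hF : ContDiffOn ℝ ∞ F (dom Ω H))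
    (e e' : ℝ × ℝ × ℝ × ℂ) {q : ℝ × ℝ × ℝ × ℂ} (hq : q ∈ dom Ω H) :
    pd Ω H e (pd Ω H e' F) q = pd Ω H e' (pd Ω H e F) q := by
  have hs : IsSymmSndFDerivWithinAt ℝ F (dom Ω H) q :=
    (hF q hq).isSymmSndFDerivWithinAt
      (by simpa using (WithTop.coe_le_coe.2 le_top : ((2 : ℕ∞) : WithTop ℕ∞) ≤ ∞))
      (uniqueDiffOn_dom hΩ hH) (dom_subset_closure_interior hΩ hH hq) hq
  have hd : DifferentiableWithinAt ℝ (fderivWithin ℝ F (dom Ω H)) (dom Ω H) q :=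
    (hF.fderivWithin (m := ∞) (uniqueDiffOn_dom hΩ hH) (by simp)).differentiableOn (by simp) q hq
  have key : ∀ a b : ℝ × ℝ × ℝ × ℂ, pd Ω H a (pd Ω H b F) q =
      fderivWithin ℝ (fderivWithin ℝ F (dom Ω H)) (dom Ω H) q a b := by
    intro a b
    have := (hd.hasFDerivWithinAt.clm_apply (hasFDerivWithinAt_const b q (dom Ω H))).fderivWithin
      (uniqueDiffOn_dom hΩ hH q hq)
    unfold pd
    rw [this]; simp
  rw [key, key]; exact hs e e'

end calculus

section slices

variable {Ω : Set (ℝ × ℝ × ℝ)} {H : Set ℂ} {F G : ℝ × ℝ × ℝ × ℂ → ℂ} {x y t : ℝ} {z : ℂ}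

theorem hasDerivAt_x (hΩ : IsOpen Ω) (hF : ContDiffOn ℝ ∞ F (dom Ω H)) (hp : (x, y, t) ∈ Ω)
    (hz : z ∈ H) : HasDerivAt (fun s => F (s, y, t, z)) (pd Ω H ex F (x, y, t, z)) x := by
  have hc : Continuous fun s : ℝ => (s, y, t) := by fun_prop
  refine (hasFDerivWithinAt_dom hF (q := (x, y, t, z)) ⟨hp, hz⟩).comp_hasDerivAt_of_eq
    (f := fun s : ℝ => (s, y, t, z)) (f' := ex) x ?_ ?_ rfl
  · exact (hasDerivAt_id x).prodMk (hasDerivAt_const x (y, t, z))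
  · filter_upwards [hc.continuousAt.preimage_mem_nhds (hΩ.mem_nhds hp)] with s hs
    exact ⟨hs, hz⟩

theorem hasDerivAt_y (hΩ : IsOpen Ω) (hF : ContDiffOn ℝ ∞ F (dom Ω H)) (hp : (x, y, t) ∈ Ω)
    (hz : z ∈ H) : HasDerivAt (fun s => F (x, s, t, z)) (pd Ω H ey F (x, y, t, z)) y := by
  have hc : Continuous fun s : ℝ => (x, s, t) := by fun_prop
  refine (hasFDerivWithinAt_dom hF (q := (x, y, t, z)) ⟨hp, hz⟩).comp_hasDerivAt_of_eq
    (f := fun s : ℝ => (x, s, t, z)) (f' := ey) y ?_ ?_ rfl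
  · exact (hasDerivAt_const y x).prodMk ((hasDerivAt_id y).prodMk (hasDerivAt_const y (t, z)))
  · filter_upwards [hc.continuousAt.preimage_mem_nhds (hΩ.mem_nhds hp)] with s hs
    exact ⟨hs, hz⟩

theorem hasDerivAt_t (hΩ : IsOpen Ω) (hF : ContDiffOn ℝ ∞ F (dom Ω H)) (hp : (x, y, t) ∈ Ω)
    (hz : z ∈ H) : HasDerivAt (fun s => F (x, y, s, z)) (pd Ω H et F (x, y, t, z)) t := by
  have hc : Continuous fun s : ℝ => (x, y, s) := by fun_prop
  refine (hasFDerivWithinAt_dom hF (q := (x, y, t, z)) ⟨hp, hz⟩).comp_hasDerivAt_of_eq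
    (f := fun s : ℝ => (x, y, s, z)) (f' := et) t ?_ ?_ rfl
  · exact (hasDerivAt_const t x).prodMk ((hasDerivAt_const t y).prodMk
      ((hasDerivAt_id t).prodMk (hasDerivAt_const t z)))
  · filter_upwards [hc.continuousAt.preimage_mem_nhds (hΩ.mem_nhds hp)] with s hs
    exact ⟨hs, hz⟩

theorem hasFDerivWithinAt_slice (hF : ContDiffOn ℝ ∞ F (dom Ω H)) (hp : (x, y, t) ∈ Ω)
    (hz : z ∈ H) : HasFDerivWithinAt (fun w => F (x, y, t, w))
      ((fderivWithin ℝ F (dom Ω H) (x, y, t, z)).comp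
        ((0 : ℂ →L[ℝ] ℝ).prod ((0 : ℂ →L[ℝ] ℝ).prod ((0 : ℂ →L[ℝ] ℝ).prod
          (ContinuousLinearMap.id ℝ ℂ))))) H z := by
  refine (hasFDerivWithinAt_dom hF (q := (x, y, t, z)) ⟨hp, hz⟩).comp
    (f := fun w : ℂ => (x, y, t, w)) z ?_ (fun w hw => ⟨hp, hw⟩)
  exact (hasFDerivWithinAt_const x z H).prodMk ((hasFDerivWithinAt_const y z H).prodMk
    ((hasFDerivWithinAt_const t z H).prodMk (hasFDerivWithinAt_id z H)))

theorem hasDerivWithinAt_of_linear (hF : ContDiffOn ℝ ∞ F (dom Ω H)) (hp : (x, y, t) ∈ Ω)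
    (hz : z ∈ H)
    (hl : ∀ w : ℂ, pd Ω H (0, 0, 0, w) F (x, y, t, z) = w * pd Ω H ez F (x, y, t, z)) :
    HasDerivWithinAt (fun w => F (x, y, t, w)) (pd Ω H ez F (x, y, t, z)) H z := by
  have h : HasFDerivWithinAt (𝕜 := ℂ) (fun w => F (x, y, t, w))
      (ContinuousLinearMap.toSpanSingleton ℂ (pd Ω H ez F (x, y, t, z))) H z := by
    refine HasFDerivWithinAt.of_restrictScalars ℝ (hasFDerivWithinAt_slice hF hp hz) ?_
    ext w
    · simp [← hl]; rfl
  exact h.hasDerivWithinAt.congr_deriv (by simp)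

theorem continuousOn_slice (hF : ContinuousOn F (dom Ω H)) (hp : (x, y, t) ∈ Ω) :
    ContinuousOn (fun w => F (x, y, t, w)) H :=
  hF.comp (f := fun w : ℂ => (x, y, t, w)) (by fun_prop) (fun w hw => ⟨hp, hw⟩)

theorem continuousOn_pd (hΩ : IsOpen Ω) (hH : IsHalfPlane H) (hF : ContDiffOn ℝ ∞ F (dom Ω H))
    (e : ℝ × ℝ × ℝ × ℂ) (hp : (x, y, t) ∈ Ω) :
    ContinuousOn (fun w => pd Ω H e F (x, y, t, w)) H :=
  continuousOn_slice (pd_smooth hΩ hH hF e).continuousOn hp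

/-- Holomorphy gives complex linearity of the derivative inside `H`; both sides are continuous on
`H`, so it persists on the real line. Thus `∂_λ` makes sense there. -/
theorem Nice.pd_linear (hΩ : IsOpen Ω) (hH : IsHalfPlane H) (hF : Nice Ω H F)
    (hp : (x, y, t) ∈ Ω) (hz : z ∈ H) (w : ℂ) :
    pd Ω H (0, 0, 0, w) F (x, y, t, z) = w * pd Ω H ez F (x, y, t, z) := by
  have key : Set.EqOn (fun z => pd Ω H (0, 0, 0, w) F (x, y, t, z))
      (fun z => w * pd Ω H ez F (x, y, t, z)) (interior H) := by
    intro z hz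
    have hd := ((hF.hol x y t hp).differentiableAt (isOpen_interior.mem_nhds hz)).hasDerivAt
    have h1 := (hasFDerivWithinAt_slice hF.smooth hp (interior_subset hz)).hasFDerivAt
      (mem_interior_iff_mem_nhds.1 hz)
    have h2 := h1.unique (hd.hasFDerivAt.restrictScalars ℝ)
    have h3 : ∀ w : ℂ, pd Ω H (0, 0, 0, w) F (x, y, t, z) =
        w * deriv (fun z => F (x, y, t, z)) z := by
      intro w
      simpa [pd] using congrArg (fun L : ℂ →L[ℝ] ℂ => L w) h2
    change pd Ω H (0, 0, 0, w) F (x, y, t, z) = w * pd Ω H ez F (x, y, t, z)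
    rw [h3 w, h3 1, one_mul]
  exact key.of_subset_closure (continuousOn_pd hΩ hH hF.smooth _ hp)
    (continuousOn_const.mul (continuousOn_pd hΩ hH hF.smooth _ hp)) interior_subset
    hH.subset_closure_interior hz

theorem Nice.hasDerivWithinAt (hΩ : IsOpen Ω) (hH : IsHalfPlane H) (hF : Nice Ω H F)
    (hp : (x, y, t) ∈ Ω) (hz : z ∈ H) :
    HasDerivWithinAt (fun w => F (x, y, t, w)) (pd Ω H ez F (x, y, t, z)) H z :=
  hasDerivWithinAt_of_linear hF.smooth hp hz (hF.pd_linear hΩ hH hp hz)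

/-- Holomorphy survives differentiation in parameters because derivatives commute: the complex
linearity of the `λ`-derivative of `F` is itself differentiated along `e`. -/
theorem Nice.pd (hΩ : IsOpen Ω) (hH : IsHalfPlane H) (hF : Nice Ω H F) (e : ℝ × ℝ × ℝ × ℂ) :
    Nice Ω H (pd Ω H e F) := by
  have hs := pd_smooth hΩ hH hF.smooth e
  refine ⟨hs, fun x y t hp z hz => ?_⟩
  refine ((hasDerivWithinAt_of_linear hs hp (interior_subset hz) fun w => ?_).mono
    interior_subset).differentiableWithinAt
  have hq : (x, y, t, z) ∈ dom Ω H := ⟨hp, interior_subset hz⟩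
  rw [pd_comm hΩ hH hF.smooth (0, 0, 0, w) e hq, pd_comm hΩ hH hF.smooth ez e hq]
  have hu := uniqueDiffOn_dom hΩ hH _ hq
  have h1 : NRH.pd Ω H e (NRH.pd Ω H (0, 0, 0, w) F) (x, y, t, z) =
      NRH.pd Ω H e (fun q => w * NRH.pd Ω H ez F q) (x, y, t, z) := by
    exact congrArg (fun L : (ℝ × ℝ × ℝ × ℂ) →L[ℝ] ℂ => L e)
      (fderivWithin_congr (f₁ := NRH.pd Ω H (0, 0, 0, w) F)
      (f := fun q => w * NRH.pd Ω H ez F q) (fun q hq => hF.pd_linear hΩ hH hq.1 hq.2 w)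
      (hF.pd_linear hΩ hH hp (interior_subset hz) w))
  rw [h1]
  have := ((hasFDerivWithinAt_dom (pd_smooth hΩ hH hF.smooth ez) hq).const_mul w).fderivWithin hu
  change fderivWithin ℝ (fun q => w * NRH.pd Ω H ez F q) _ _ e = _
  rw [this]; rfl

theorem Nice.add (hF : Nice Ω H F) (hG : Nice Ω H G) : Nice Ω H (fun q => F q + G q) :=
  ⟨hF.smooth.add hG.smooth, fun x y t hp => (hF.hol x y t hp).add (hG.hol x y t hp)⟩

theorem Nice.sub (hF : Nice Ω H F) (hG : Nice Ω H G) : Nice Ω H (fun q => F q - G q) :=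
  ⟨hF.smooth.sub hG.smooth, fun x y t hp => (hF.hol x y t hp).sub (hG.hol x y t hp)⟩

theorem Nice.mul (hF : Nice Ω H F) (hG : Nice Ω H G) : Nice Ω H (fun q => F q * G q) :=
  ⟨hF.smooth.mul hG.smooth, fun x y t hp => (hF.hol x y t hp).mul (hG.hol x y t hp)⟩

theorem Nice.pow (hF : Nice Ω H F) (n : ℕ) : Nice Ω H (fun q => F q ^ n) :=
  ⟨hF.smooth.pow n, fun x y t hp => (hF.hol x y t hp).pow n⟩

theorem Nice.const (c : ℂ) : Nice Ω H (fun _ => c) :=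
  ⟨contDiffOn_const, fun _ _ _ _ => differentiableOn_const c⟩

theorem nice_z : Nice Ω H (fun q => q.2.2.2) :=
  ⟨by fun_prop, fun _ _ _ _ => differentiableOn_id⟩

end slices

/-! ### Smooth fields of `x, y, t` and their derivatives -/

/-- Smooth scalar fields on `Ω`. -/
def FieldSmooth (Ω : Set (ℝ × ℝ × ℝ)) (u : Field) : Prop :=
  ContDiffOn ℝ ∞ (fun p : ℝ × ℝ × ℝ => u p.1 p.2.1 p.2.2) Ω

namespace FieldSmooth

variable {Ω : Set (ℝ × ℝ × ℝ)} {H : Set ℂ} {u w : Field} {x y t : ℝ}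

theorem nice (hu : FieldSmooth Ω u) : Nice Ω H (fun q => u q.1 q.2.1 q.2.2.1) :=
  ⟨ContDiffOn.comp (g := fun p : ℝ × ℝ × ℝ => u p.1 p.2.1 p.2.2)
    (f := fun q : ℝ × ℝ × ℝ × ℂ => (q.1, q.2.1, q.2.2.1)) hu
    (by fun_prop) (fun _ hq => hq.1),
   fun x y t _ => differentiableOn_const (u x y t)⟩

theorem of_nice {F : ℝ × ℝ × ℝ × ℂ → ℂ} (hF : ContDiffOn ℝ ∞ F (dom Ω H)) {z : ℂ} (hz : z ∈ H)
    (h : ∀ x y t, (x, y, t) ∈ Ω → u x y t = F (x, y, t, z)) : FieldSmooth Ω u := by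
  refine ContDiffOn.congr (f := fun p : ℝ × ℝ × ℝ => F (p.1, p.2.1, p.2.2, z)) ?_
    (fun p hp => h p.1 p.2.1 p.2.2 hp)
  exact ContDiffOn.comp (f := fun p : ℝ × ℝ × ℝ => (p.1, p.2.1, p.2.2, z)) hF (by fun_prop)
    (fun p hp => ⟨hp, hz⟩)

theorem hasDerivAt_x (hΩ : IsOpen Ω) (hu : FieldSmooth Ω u) (hp : (x, y, t) ∈ Ω) :
    HasDerivAt (fun s => u s y t) (dx u x y t) x :=
  (NRH.hasDerivAt_x hΩ (hu.nice (H := upper)).smooth hp (z := 0)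
    (by simp [upper])).differentiableAt.hasDerivAt

theorem hasDerivAt_y (hΩ : IsOpen Ω) (hu : FieldSmooth Ω u) (hp : (x, y, t) ∈ Ω) :
    HasDerivAt (fun s => u x s t) (dy u x y t) y :=
  (NRH.hasDerivAt_y hΩ (hu.nice (H := upper)).smooth hp (z := 0)
    (by simp [upper])).differentiableAt.hasDerivAt

theorem hasDerivAt_t (hΩ : IsOpen Ω) (hu : FieldSmooth Ω u) (hp : (x, y, t) ∈ Ω) :
    HasDerivAt (fun s => u x y s) (dt u x y t) t :=
  (NRH.hasDerivAt_t hΩ (hu.nice (H := upper)).smooth hp (z := 0)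
    (by simp [upper])).differentiableAt.hasDerivAt

theorem pd_x (hΩ : IsOpen Ω) (hu : FieldSmooth Ω u) (hp : (x, y, t) ∈ Ω) {z : ℂ} (hz : z ∈ H) :
    pd Ω H ex (fun q => u q.1 q.2.1 q.2.2.1) (x, y, t, z) = dx u x y t :=
  (NRH.hasDerivAt_x hΩ hu.nice.smooth hp hz).deriv.symm

theorem pd_y (hΩ : IsOpen Ω) (hu : FieldSmooth Ω u) (hp : (x, y, t) ∈ Ω) {z : ℂ} (hz : z ∈ H) :
    pd Ω H ey (fun q => u q.1 q.2.1 q.2.2.1) (x, y, t, z) = dy u x y t :=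
  (NRH.hasDerivAt_y hΩ hu.nice.smooth hp hz).deriv.symm

theorem pd_t (hΩ : IsOpen Ω) (hu : FieldSmooth Ω u) (hp : (x, y, t) ∈ Ω) {z : ℂ} (hz : z ∈ H) :
    pd Ω H et (fun q => u q.1 q.2.1 q.2.2.1) (x, y, t, z) = dt u x y t :=
  (NRH.hasDerivAt_t hΩ hu.nice.smooth hp hz).deriv.symm

theorem dx (hΩ : IsOpen Ω) (hu : FieldSmooth Ω u) : FieldSmooth Ω (dx u) :=
  of_nice (pd_smooth hΩ isHalfPlane_upper (hu.nice (H := upper)).smooth ex) (z := 0) (by simp [upper])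
    fun _ _ _ hp => (hu.pd_x hΩ hp (by simp [upper])).symm

theorem dy (hΩ : IsOpen Ω) (hu : FieldSmooth Ω u) : FieldSmooth Ω (dy u) :=
  of_nice (pd_smooth hΩ isHalfPlane_upper (hu.nice (H := upper)).smooth ey) (z := 0) (by simp [upper])
    fun _ _ _ hp => (hu.pd_y hΩ hp (by simp [upper])).symm

theorem dt (hΩ : IsOpen Ω) (hu : FieldSmooth Ω u) : FieldSmooth Ω (dt u) :=
  of_nice (pd_smooth hΩ isHalfPlane_upper (hu.nice (H := upper)).smooth et) (z := 0) (by simp [upper])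
    fun _ _ _ hp => (hu.pd_t hΩ hp (by simp [upper])).symm

theorem add (hu : FieldSmooth Ω u) (hw : FieldSmooth Ω w) :
    FieldSmooth Ω (fun x y t => u x y t + w x y t) := ContDiffOn.add hu hw

theorem mul (hu : FieldSmooth Ω u) (hw : FieldSmooth Ω w) :
    FieldSmooth Ω (fun x y t => u x y t * w x y t) := ContDiffOn.mul hu hw

theorem const (c : ℂ) : FieldSmooth Ω (fun _ _ _ => c) := contDiffOn_const

theorem coord_x : FieldSmooth Ω (fun x _ _ => (x : ℂ)) :=
  (Complex.ofRealCLM.contDiff.comp contDiff_fst).contDiffOn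

theorem coord_y : FieldSmooth Ω (fun _ y _ => (y : ℂ)) :=
  (Complex.ofRealCLM.contDiff.comp (contDiff_fst.comp contDiff_snd)).contDiffOn

theorem coord_t : FieldSmooth Ω (fun _ _ t => (t : ℂ)) :=
  (Complex.ofRealCLM.contDiff.comp (contDiff_snd.comp contDiff_snd)).contDiffOn

theorem congr_deriv_x (hΩ : IsOpen Ω) (h : ∀ x y t, (x, y, t) ∈ Ω → u x y t = w x y t)
    (hp : (x, y, t) ∈ Ω) : NRH.dx u x y t = NRH.dx w x y t := by
  have hc : Continuous fun s : ℝ => (s, y, t) := by fun_prop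
  refine Filter.EventuallyEq.deriv_eq ?_
  filter_upwards [hc.continuousAt.preimage_mem_nhds (hΩ.mem_nhds hp)] with s hs using h _ _ _ hs

theorem congr_deriv_y (hΩ : IsOpen Ω) (h : ∀ x y t, (x, y, t) ∈ Ω → u x y t = w x y t)
    (hp : (x, y, t) ∈ Ω) : NRH.dy u x y t = NRH.dy w x y t := by
  have hc : Continuous fun s : ℝ => (x, s, t) := by fun_prop
  refine Filter.EventuallyEq.deriv_eq ?_
  filter_upwards [hc.continuousAt.preimage_mem_nhds (hΩ.mem_nhds hp)] with s hs using h _ _ _ hs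

theorem dx_dy (hΩ : IsOpen Ω) (hu : FieldSmooth Ω u) (hp : (x, y, t) ∈ Ω) :
    NRH.dx (NRH.dy u) x y t = NRH.dy (NRH.dx u) x y t := by
  have h0 : (0 : ℂ) ∈ upper := by simp [upper]
  have hn := (hu.nice (H := upper)).smooth
  have h1 := (NRH.hasDerivAt_x hΩ (pd_smooth hΩ isHalfPlane_upper hn ey) hp h0).deriv
  have h2 := (NRH.hasDerivAt_y hΩ (pd_smooth hΩ isHalfPlane_upper hn ex) hp h0).deriv
  have h3 := congr_deriv_x (u := NRH.dy u) (w := fun x y t => pd Ω upper ey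
    (fun q => u q.1 q.2.1 q.2.2.1) (x, y, t, 0)) hΩ
    (fun _ _ _ hp => (hu.pd_y hΩ hp h0).symm) hp
  have h4 := congr_deriv_y (u := NRH.dx u) (w := fun x y t => pd Ω upper ex
    (fun q => u q.1 q.2.1 q.2.2.1) (x, y, t, 0)) hΩ
    (fun _ _ _ hp => (hu.pd_x hΩ hp h0).symm) hp
  rw [h3, h4]
  exact h1.trans ((pd_comm hΩ isHalfPlane_upper hn _ _ ⟨hp, h0⟩).trans h2.symm)

end FieldSmooth

/-! ### Limits as `λ → ∞` -/

/-- The filter `λ → ∞` in `H`. -/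
abbrev atInf (H : Set ℂ) : Filter ℂ := Bornology.cobounded ℂ ⊓ Filter.principal H

section limits

variable {Ω : Set (ℝ × ℝ × ℝ)} {H : Set ℂ} {F : ℝ × ℝ × ℝ × ℂ → ℂ} {x y t : ℝ}

theorem IsHalfPlane.tendsto_ofReal (hH : IsHalfPlane H) :
    Filter.Tendsto (fun l : ℝ => (l : ℂ)) Filter.atTop (atInf H) := by
  refine Filter.tendsto_inf.2 ⟨?_, Filter.tendsto_principal.2 (.of_forall hH.ofReal_mem)⟩
  rw [← tendsto_norm_atTop_iff_cobounded]
  simpa using Filter.tendsto_abs_atTop_atTop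

theorem IsHalfPlane.neBot_atInf (hH : IsHalfPlane H) : (atInf H).NeBot :=
  hH.tendsto_ofReal.neBot

theorem eventually_atInf : ∀ᶠ z in atInf H, z ∈ H ∧ z ≠ 0 := by
  have h1 : ∀ᶠ z in atInf H, z ∈ H :=
    Filter.mem_inf_of_right (Filter.mem_principal_self H)
  have h2 : ∀ᶠ z in atInf H, z ≠ 0 :=
    Filter.mem_inf_of_left (Bornology.eventually_ne_cobounded 0)
  exact h1.and h2

theorem tendsto_inv_atInf : Filter.Tendsto (fun z : ℂ => z⁻¹) (atInf H) (𝓝 0) :=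
  (Filter.tendsto_inv₀_cobounded (α := ℂ)).mono_left inf_le_left

theorem IsHalfPlane.tendsto_inv (hH : IsHalfPlane H) :
    Filter.Tendsto (fun z : ℂ => z⁻¹) (atInf H) (𝓝[conjSet H \ {0}] 0) := by
  refine tendsto_nhdsWithin_iff.2 ⟨tendsto_inv_atInf, ?_⟩
  filter_upwards [eventually_atInf] with z hz
  exact ⟨hH.inv_mem hz.1, by simpa using hz.2⟩

theorem tendsto_slice (hH : IsHalfPlane H) (hF : ContDiffOn ℝ ∞ F (dom Ω (conjSet H)))
    (hp : (x, y, t) ∈ Ω) :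
    Filter.Tendsto (fun z => F (x, y, t, z⁻¹)) (atInf H) (𝓝 (F (x, y, t, 0))) :=
  ((continuousOn_slice hF.continuousOn hp) 0 hH.conj.zero_mem).tendsto.comp
    (hH.tendsto_inv.mono_right (nhdsWithin_mono _ Set.sdiff_subset))

/-- With `μ = 1/λ` the product is the difference quotient of `F` at `μ = 0`. This reads off the
coefficient of `1/λ`. -/
theorem tendsto_mul_slice (hΩ : IsOpen Ω) (hH : IsHalfPlane H) (hF : Nice Ω (conjSet H) F)
    (hp : (x, y, t) ∈ Ω) (h0 : F (x, y, t, 0) = 0) :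
    Filter.Tendsto (fun z => z * F (x, y, t, z⁻¹)) (atInf H)
      (𝓝 (pd Ω (conjSet H) ez F (x, y, t, 0))) := by
  have h := (hasDerivWithinAt_iff_tendsto_slope.1
    (hF.hasDerivWithinAt hΩ hH.conj hp hH.conj.zero_mem)).comp hH.tendsto_inv
  refine h.congr fun z => ?_
  simp [slope_def_field, h0, div_eq_mul_inv, mul_comm]

end limits

/-! ### The expansion at infinity -/

/-- The large `λ` expansion of `π` in terms of smooth functions `g`, `ρ` of `(x, y, t, 1 / λ)`. -/
structure Expansion (Ω : Set (ℝ × ℝ × ℝ)) (H : Set ℂ) (u v : Field) (π : Wave)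
    (g ρ : ℝ × ℝ × ℝ × ℂ → ℂ) : Prop where
  nice_g : Nice Ω (conjSet H) g
  nice_ρ : Nice Ω (conjSet H) ρ
  eq_zero : ∀ x y t, (x, y, t) ∈ Ω → ∀ z ∈ H, z ≠ 0 →
    π x y t z 0 = z + 2 * u x y t + z⁻¹ * g (x, y, t, z⁻¹)
  eq_one : ∀ x y t, (x, y, t) ∈ Ω → ∀ z ∈ H, z ≠ 0 →
    π x y t z 1 = ρ (x, y, t, z⁻¹) + y * π x y t z 0 - t / 2 * π x y t z 0 ^ 2 + x
  g_zero : ∀ x y t, (x, y, t) ∈ Ω → g (x, y, t, 0) = 2 * dy v x y t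
  ρ_zero : ∀ x y t, (x, y, t) ∈ Ω → ρ (x, y, t, 0) = 0
  ρ_one : ∀ x y t, (x, y, t) ∈ Ω → pd Ω (conjSet H) ez ρ (x, y, t, 0) = 2 * v x y t

section expansion

variable {Ω : Set (ℝ × ℝ × ℝ)} {H : Set ℂ} {u v : Field} {π : Wave}

/-- The remainder class only asks that `g` be smooth; its holomorphy in `μ` is inherited from `r`,
since `g = μ⁻¹ r(1/μ)`. -/
theorem nice_of_remainder (hH : IsHalfPlane H) {r : ℝ → ℝ → ℝ → ℂ → ℂ}
    {g : ℝ × ℝ × ℝ × ℂ → ℂ}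
    (hr : ∀ x y t, (x, y, t) ∈ Ω → DifferentiableOn ℂ (r x y t) (interior H))
    (hg : ContDiffOn ℝ ∞ g (dom Ω (conjSet H)))
    (h : ∀ x y t, (x, y, t) ∈ Ω → ∀ z ∈ H, z ≠ 0 → r x y t z = z⁻¹ * g (x, y, t, z⁻¹)) :
    Nice Ω (conjSet H) g := by
  refine ⟨hg, fun x y t hp => ?_⟩
  have h1 : DifferentiableOn ℂ (fun w : ℂ => w⁻¹ * r x y t w⁻¹) (interior (conjSet H)) := by
    have hi : DifferentiableOn ℂ (fun w : ℂ => w⁻¹) (interior (conjSet H)) :=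
      fun w hw => (differentiableAt_inv (hH.inv_mem_interior hw).1).differentiableWithinAt
    exact hi.mul ((hr x y t hp).comp hi fun w hw => (hH.inv_mem_interior hw).2)
  refine h1.congr fun w hw => ?_
  obtain ⟨h2, h3⟩ := hH.inv_mem_interior hw
  rw [h x y t hp _ (interior_subset h3) (inv_ne_zero h2)]
  simp [h2]

theorem IsNormalized.exists_expansion (hΩ : IsOpen Ω) (hH : IsHalfPlane H)
    (hu : FieldSmooth Ω u) (hv : FieldSmooth Ω v) (h : IsNormalized Ω H u v π) :
    ∃ g ρ, Expansion Ω H u v π g ρ := by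
  obtain ⟨g, hg, hge⟩ := h.expansion₁
  obtain ⟨k, hk, hke⟩ := h.expansion₂
  have ng : Nice Ω (conjSet H) g := nice_of_remainder hH (fun x y t hp =>
    (h.holomorphic x y t hp 0).sub (differentiableOn_id.add (differentiableOn_const _))) hg hge
  have nk : Nice Ω (conjSet H) k := nice_of_remainder hH (fun x y t hp =>
    (h.holomorphic x y t hp 1).sub (by fun_prop)) hk hke
  have nx : Nice Ω (conjSet H) (fun q => (q.1 : ℂ)) := FieldSmooth.coord_x.nice
  have ny : Nice Ω (conjSet H) (fun q => (q.2.1 : ℂ)) := FieldSmooth.coord_y.nice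
  have nt : Nice Ω (conjSet H) (fun q => (q.2.2.1 : ℂ)) := FieldSmooth.coord_t.nice
  have nu := hu.nice (H := conjSet H)
  have nvy := (hv.dy hΩ).nice (H := conjSet H)
  -- This is `π₂ - yπ₁ + tπ₁²/2 - x` with both expansions inserted; the nonnegative powers of `λ`
  -- cancel except for `t(g - 2v_y)`.
  let ρ : ℝ × ℝ × ℝ × ℂ → ℂ := fun q =>
    q.2.2.1 * (g q - 2 * dy v q.1 q.2.1 q.2.2.1) + q.2.2.2 * (k q - q.2.1 * g q
      + 2 * q.2.2.1 * u q.1 q.2.1 q.2.2.1 * g q + 1 / 2 * q.2.2.1 * q.2.2.2 * g q ^ 2)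
  have nρ : Nice Ω (conjSet H) ρ :=
    (nt.mul (ng.sub ((Nice.const 2).mul nvy))).add (nice_z.mul (((nk.sub (ny.mul ng)).add
      ((((Nice.const 2).mul nt).mul nu).mul ng)).add
      ((((Nice.const (1 / 2)).mul nt).mul nice_z).mul (ng.pow 2))))
  have e0 : ∀ x y t, (x, y, t) ∈ Ω → ∀ z ∈ H, z ≠ 0 →
      π x y t z 0 = z + 2 * u x y t + z⁻¹ * g (x, y, t, z⁻¹) := by
    intro x y t hp z hz h0
    rw [← hge x y t hp z hz h0]; ring
  have e1 : ∀ x y t, (x, y, t) ∈ Ω → ∀ z ∈ H, z ≠ 0 →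
      π x y t z 1 = ρ (x, y, t, z⁻¹) + y * π x y t z 0 - t / 2 * π x y t z 0 ^ 2 + x := by
    intro x y t hp z hz h0
    have := hke x y t hp z hz h0
    rw [sub_eq_iff_eq_add] at this
    rw [this, e0 x y t hp z hz h0]
    simp only [ρ]
    field_simp
    ring
  have hlim : ∀ x y t, (x, y, t) ∈ Ω →
      Filter.Tendsto (fun z => z * ρ (x, y, t, z⁻¹)) (atInf H) (𝓝 (2 * v x y t)) := by
    intro x y t hp
    refine ((h.recovery x y t hp).const_mul 2).congr' ?_
    filter_upwards [eventually_atInf] with z hz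
    rw [e1 x y t hp z hz.1 hz.2]; ring
  have := hH.neBot_atInf
  have ρ0 : ∀ x y t, (x, y, t) ∈ Ω → ρ (x, y, t, 0) = 0 := by
    intro x y t hp
    refine tendsto_nhds_unique (tendsto_slice hH nρ.smooth hp) ?_
    have := tendsto_inv_atInf.mul (hlim x y t hp)
    rw [zero_mul] at this
    refine this.congr' ?_
    filter_upwards [eventually_atInf] with z hz
    rw [inv_mul_cancel_left₀ hz.2]
  have g0 : ∀ x y t, (x, y, t) ∈ Ω → t ≠ 0 → g (x, y, t, 0) = 2 * dy v x y t := by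
    intro x y t hp ht
    have := ρ0 x y t hp
    simp only [ρ, zero_mul, add_zero, mul_eq_zero, Complex.ofReal_eq_zero, ht, false_or] at this
    exact sub_eq_zero.1 this
  refine ⟨g, ρ, ng, nρ, e0, e1, fun x y t hp => ?_, ρ0, fun x y t hp => ?_⟩
  -- At `t = 0` the relation `t(g - 2v_y) = 0` says nothing, so the value of `g` is obtained as a
  -- limit from nearby nonzero times.
  · have c1 := (hasDerivAt_t hΩ hg hp hH.conj.zero_mem).continuousAt.tendsto
    have c2 := (((hv.dy hΩ).hasDerivAt_t hΩ hp).continuousAt.tendsto).const_mul 2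
    have hc : Continuous fun s : ℝ => (x, y, s) := by fun_prop
    have hn : ∀ᶠ s in 𝓝[≠] t, (x, y, s) ∈ Ω := nhdsWithin_le_nhds
      (hc.continuousAt.preimage_mem_nhds (hΩ.mem_nhds hp))
    have hne : ∀ᶠ s in 𝓝[≠] t, s ≠ 0 := by
      by_cases h0 : t = 0
      · subst h0; exact self_mem_nhdsWithin
      · exact nhdsWithin_le_nhds (isOpen_ne.mem_nhds h0)
    refine tendsto_nhds_unique (c1.mono_left (nhdsWithin_le_nhds (s := {t}ᶜ)))
      ((c2.mono_left nhdsWithin_le_nhds).congr' ?_)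
    filter_upwards [hn, hne] with s h1 h2 using (g0 x y s h1 h2).symm
  · exact tendsto_nhds_unique (tendsto_mul_slice hΩ hH nρ hp (ρ0 x y t hp)) (hlim x y t hp)

end expansion

/-! ### Derivatives of `π` and their defects in terms of `g` and `ρ` -/

def wx (π : Wave) : Wave := fun x y t z i => deriv (fun s => π s y t z i) x
def wy (π : Wave) : Wave := fun x y t z i => deriv (fun s => π x s t z i) y
def wt (π : Wave) : Wave := fun x y t z i => deriv (fun s => π x y s z i) t
def wz (H : Set ℂ) (π : Wave) : Wave := fun x y t z i =>
  derivWithin (fun w => π x y t w i) H z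

theorem lax₁_eq (u : Field) (H : Set ℂ) (π : Wave) (x y t : ℝ) :
    lax₁ u H π x y t = fun z => (wy π x y t z + (-z) • wx π x y t z)
      + (2 * dx u x y t * z) • wz H π x y t z := by
  funext z i
  simp only [lax₁, wx, wy, wz, Pi.add_apply, Pi.smul_apply, smul_eq_mul]
  ring

theorem lax₂_eq (u : Field) (H : Set ℂ) (π : Wave) (x y t : ℝ) :
    lax₂ u H π x y t = fun z => (wt π x y t z + (1 / 2 * z ^ 2 + u x y t * z) • wx π x y t z)
      + (-(dx u x y t * z + dy u x y t + 2 * u x y t * dx u x y t) * z) • wz H π x y t z := by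
  funext z i
  simp only [lax₂, wx, wt, wz, Pi.add_apply, Pi.smul_apply, smul_eq_mul]
  ring

section eventually

variable {Ω : Set (ℝ × ℝ × ℝ)} {x y t : ℝ}

theorem eventually_x (hΩ : IsOpen Ω) (hp : (x, y, t) ∈ Ω) : ∀ᶠ s in 𝓝 x, (s, y, t) ∈ Ω :=
  (by fun_prop : Continuous fun s : ℝ => (s, y, t)).continuousAt.preimage_mem_nhds
    (hΩ.mem_nhds hp)

theorem eventually_y (hΩ : IsOpen Ω) (hp : (x, y, t) ∈ Ω) : ∀ᶠ s in 𝓝 y, (x, s, t) ∈ Ω :=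
  (by fun_prop : Continuous fun s : ℝ => (x, s, t)).continuousAt.preimage_mem_nhds
    (hΩ.mem_nhds hp)

theorem eventually_t (hΩ : IsOpen Ω) (hp : (x, y, t) ∈ Ω) : ∀ᶠ s in 𝓝 t, (x, y, s) ∈ Ω :=
  (by fun_prop : Continuous fun s : ℝ => (x, y, s)).continuousAt.preimage_mem_nhds
    (hΩ.mem_nhds hp)

end eventually

/-- The second component of a tangent vector `X` in the coordinates
`(π₁, π₂ - y π₁ + t π₁² / 2 - x)`. -/
def defect (y t : ℝ) (π X : ℂ → Fin 2 → ℂ) (z : ℂ) : ℂ := X z 1 - (y - t * π z 0) * X z 0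

namespace Expansion

variable {Ω : Set (ℝ × ℝ × ℝ)} {H : Set ℂ} {u v : Field} {π : Wave}
  {g ρ : ℝ × ℝ × ℝ × ℂ → ℂ} {x y t : ℝ} {z : ℂ}

section formulas

variable (h : Expansion Ω H u v π g ρ) (hΩ : IsOpen Ω) (hH : IsHalfPlane H)
  (hu : FieldSmooth Ω u) (hp : (x, y, t) ∈ Ω) (hz : z ∈ H) (h0 : z ≠ 0)

include h hΩ hH hu hp hz h0

theorem hasDerivAt_x_zero : HasDerivAt (fun s => π s y t z 0)
    (2 * dx u x y t + z⁻¹ * pd Ω (conjSet H) ex g (x, y, t, z⁻¹)) x := by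
  have h1 := (((hu.hasDerivAt_x hΩ hp).const_mul 2).const_add z).add
    ((NRH.hasDerivAt_x hΩ h.nice_g.smooth hp (hH.inv_mem hz)).const_mul z⁻¹)
  refine h1.congr_of_eventuallyEq ?_
  filter_upwards [eventually_x hΩ hp] with s hs using h.eq_zero s y t hs z hz h0

theorem hasDerivAt_y_zero : HasDerivAt (fun s => π x s t z 0)
    (2 * dy u x y t + z⁻¹ * pd Ω (conjSet H) ey g (x, y, t, z⁻¹)) y := by
  have h1 := (((hu.hasDerivAt_y hΩ hp).const_mul 2).const_add z).add
    ((NRH.hasDerivAt_y hΩ h.nice_g.smooth hp (hH.inv_mem hz)).const_mul z⁻¹)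
  refine h1.congr_of_eventuallyEq ?_
  filter_upwards [eventually_y hΩ hp] with s hs using h.eq_zero x s t hs z hz h0

theorem hasDerivAt_t_zero : HasDerivAt (fun s => π x y s z 0)
    (2 * dt u x y t + z⁻¹ * pd Ω (conjSet H) et g (x, y, t, z⁻¹)) t := by
  have h1 := (((hu.hasDerivAt_t hΩ hp).const_mul 2).const_add z).add
    ((NRH.hasDerivAt_t hΩ h.nice_g.smooth hp (hH.inv_mem hz)).const_mul z⁻¹)
  refine h1.congr_of_eventuallyEq ?_
  filter_upwards [eventually_t hΩ hp] with s hs using h.eq_zero x y s hs z hz h0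

omit hu in
theorem hasDerivWithinAt_zero : HasDerivWithinAt (fun w => π x y t w 0)
    (1 - z⁻¹ ^ 2 * (g (x, y, t, z⁻¹) + z⁻¹ * pd Ω (conjSet H) ez g (x, y, t, z⁻¹))) H z := by
  have hi := (hasDerivAt_inv h0).hasDerivWithinAt (s := H)
  have hg := HasDerivWithinAt.comp z
    (h.nice_g.hasDerivWithinAt hΩ hH.conj hp (hH.inv_mem hz)) hi (fun w hw => hH.inv_mem hw)
  have h1 := ((hasDerivWithinAt_id z H).add_const (2 * u x y t)).add (hi.mul hg)
  refine (h1.congr_of_eventuallyEq ?_ (h.eq_zero x y t hp z hz h0)).congr_deriv ?_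
  · filter_upwards [self_mem_nhdsWithin, nhdsWithin_le_nhds (isOpen_ne.mem_nhds h0)] with w hw hw0
      using h.eq_zero x y t hp w hw hw0
  · simp only [Function.comp]
    field_simp
    ring

theorem hasDerivAt_x_one : HasDerivAt (fun s => π s y t z 1)
    (pd Ω (conjSet H) ex ρ (x, y, t, z⁻¹) + (y - t * π x y t z 0) * wx π x y t z 0 + 1) x := by
  have h0' := (h.hasDerivAt_x_zero hΩ hH hu hp hz h0).differentiableAt.hasDerivAt
  have h1 := (((NRH.hasDerivAt_x hΩ h.nice_ρ.smooth hp (hH.inv_mem hz)).add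
    (h0'.const_mul (y : ℂ))).sub ((h0'.pow 2).const_mul (t / 2 : ℂ))).add
    (hasDerivAt_id x).ofReal_comp
  refine (h1.congr_of_eventuallyEq ?_).congr_deriv ?_
  · filter_upwards [eventually_x hΩ hp] with s hs using h.eq_one s y t hs z hz h0
  · simp only [wx]; push_cast; ring

theorem hasDerivAt_y_one : HasDerivAt (fun s => π x s t z 1)
    (pd Ω (conjSet H) ey ρ (x, y, t, z⁻¹) + (y - t * π x y t z 0) * wy π x y t z 0
      + π x y t z 0) y := by
  have h0' := (h.hasDerivAt_y_zero hΩ hH hu hp hz h0).differentiableAt.hasDerivAt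
  have h1 := (((NRH.hasDerivAt_y hΩ h.nice_ρ.smooth hp (hH.inv_mem hz)).add
    ((hasDerivAt_id y).ofReal_comp.mul h0')).sub ((h0'.pow 2).const_mul (t / 2 : ℂ))).add_const
    (x : ℂ)
  refine (h1.congr_of_eventuallyEq ?_).congr_deriv ?_
  · filter_upwards [eventually_y hΩ hp] with s hs using h.eq_one x s t hs z hz h0
  · simp only [wy, id]; push_cast; ring

theorem hasDerivAt_t_one : HasDerivAt (fun s => π x y s z 1)
    (pd Ω (conjSet H) et ρ (x, y, t, z⁻¹) + (y - t * π x y t z 0) * wt π x y t z 0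
      - 1 / 2 * π x y t z 0 ^ 2) t := by
  have h0' := (h.hasDerivAt_t_zero hΩ hH hu hp hz h0).differentiableAt.hasDerivAt
  have h1 := (((NRH.hasDerivAt_t hΩ h.nice_ρ.smooth hp (hH.inv_mem hz)).add
    (h0'.const_mul (y : ℂ))).sub (((hasDerivAt_id t).ofReal_comp.div_const 2).mul
    (h0'.pow 2))).add_const (x : ℂ)
  refine (h1.congr_of_eventuallyEq ?_).congr_deriv ?_
  · filter_upwards [eventually_t hΩ hp] with s hs using h.eq_one x y s hs z hz h0
  · simp only [wt, id, Pi.pow_apply]; push_cast; ring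

omit hu in
theorem hasDerivWithinAt_one : HasDerivWithinAt (fun w => π x y t w 1)
    (-(z⁻¹ ^ 2 * pd Ω (conjSet H) ez ρ (x, y, t, z⁻¹))
      + (y - t * π x y t z 0) * wz H π x y t z 0) H z := by
  have h0' := (h.hasDerivWithinAt_zero hΩ hH hp hz h0).differentiableWithinAt.hasDerivWithinAt
  have hi := (hasDerivAt_inv h0).hasDerivWithinAt (s := H)
  have hg := HasDerivWithinAt.comp z
    (h.nice_ρ.hasDerivWithinAt hΩ hH.conj hp (hH.inv_mem hz)) hi (fun w hw => hH.inv_mem hw)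
  have h1 := ((hg.add (h0'.const_mul (y : ℂ))).sub
    ((h0'.pow 2).const_mul (t / 2 : ℂ))).add_const (x : ℂ)
  refine (h1.congr_of_eventuallyEq ?_ (h.eq_one x y t hp z hz h0)).congr_deriv ?_
  · filter_upwards [self_mem_nhdsWithin, nhdsWithin_le_nhds (isOpen_ne.mem_nhds h0)] with w hw hw0
      using h.eq_one x y t hp w hw hw0
  · simp only [wz]; field_simp; push_cast; ring

theorem wx_zero : wx π x y t z 0 =
    2 * dx u x y t + z⁻¹ * pd Ω (conjSet H) ex g (x, y, t, z⁻¹) :=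
  (h.hasDerivAt_x_zero hΩ hH hu hp hz h0).deriv

theorem wy_zero : wy π x y t z 0 =
    2 * dy u x y t + z⁻¹ * pd Ω (conjSet H) ey g (x, y, t, z⁻¹) :=
  (h.hasDerivAt_y_zero hΩ hH hu hp hz h0).deriv

theorem wt_zero : wt π x y t z 0 =
    2 * dt u x y t + z⁻¹ * pd Ω (conjSet H) et g (x, y, t, z⁻¹) :=
  (h.hasDerivAt_t_zero hΩ hH hu hp hz h0).deriv

omit hu in
theorem wz_zero : wz H π x y t z 0 =
    1 - z⁻¹ ^ 2 * (g (x, y, t, z⁻¹) + z⁻¹ * pd Ω (conjSet H) ez g (x, y, t, z⁻¹)) :=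
  (h.hasDerivWithinAt_zero hΩ hH hp hz h0).derivWithin (hH.uniqueDiffOn z hz)

/-- Differentiating `π₂ = ρ + yπ₁ - tπ₁²/2 + x`, the defect removes every term with a derivative of
`π₁`. What is left is the derivative of `ρ` and that of the explicit `x, y, t`. The same holds for
the other three variables. -/
theorem defect_wx : defect y t (π x y t) (wx π x y t) z =
    1 + pd Ω (conjSet H) ex ρ (x, y, t, z⁻¹) := by
  have : wx π x y t z 1 = _ := (h.hasDerivAt_x_one hΩ hH hu hp hz h0).deriv
  rw [defect, this]; ring

theorem defect_wy : defect y t (π x y t) (wy π x y t) z =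
    π x y t z 0 + pd Ω (conjSet H) ey ρ (x, y, t, z⁻¹) := by
  have : wy π x y t z 1 = _ := (h.hasDerivAt_y_one hΩ hH hu hp hz h0).deriv
  rw [defect, this]; ring

theorem defect_wt : defect y t (π x y t) (wt π x y t) z =
    -(1 / 2 * π x y t z 0 ^ 2) + pd Ω (conjSet H) et ρ (x, y, t, z⁻¹) := by
  have : wt π x y t z 1 = _ := (h.hasDerivAt_t_one hΩ hH hu hp hz h0).deriv
  rw [defect, this]; ring

omit hu in
theorem defect_wz : defect y t (π x y t) (wz H π x y t) z =
    -(z⁻¹ ^ 2 * pd Ω (conjSet H) ez ρ (x, y, t, z⁻¹)) := by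
  have : wz H π x y t z 1 = _ :=
    (h.hasDerivWithinAt_one hΩ hH hp hz h0).derivWithin (hH.uniqueDiffOn z hz)
  rw [defect, this]; ring

end formulas

end Expansion

/-! ### The linearised jump relation -/

/-- Pairs of functions in the two half planes that satisfy the linearised jump relation. -/
structure LinSol (R : (Fin 2 → ℂ) → (Fin 2 → ℂ)) (ξ : ℂ → Fin 2 → ℂ)
    (ψp ψm : ℂ → Fin 2 → ℂ) : Prop where
  cont_plus : ContinuousOn ψp upper
  diff_plus : DifferentiableOn ℂ ψp (interior upper)
  cont_minus : ContinuousOn ψm lower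
  diff_minus : DifferentiableOn ℂ ψm (interior lower)
  jump : ∀ l : ℝ, ψp l = jacobian R (ξ l) *ᵥ ψm l

namespace LinSol

variable {R : (Fin 2 → ℂ) → (Fin 2 → ℂ)} {ξ ψp ψm φp φm : ℂ → Fin 2 → ℂ}

theorem add (h : LinSol R ξ ψp ψm) (h' : LinSol R ξ φp φm) :
    LinSol R ξ (fun z => ψp z + φp z) (fun z => ψm z + φm z) :=
  ⟨h.1.add h'.1, h.2.add h'.2, h.3.add h'.3, h.4.add h'.4,
    fun l => by rw [h.jump, h'.jump, Matrix.mulVec_add]⟩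

/-- The multiplier must be one entire function for both half planes; the coefficients of `L₁` and
`L₂` are polynomials in `λ`. -/
theorem smul (h : LinSol R ξ ψp ψm) {f : ℂ → ℂ} (hf : Differentiable ℂ f) :
    LinSol R ξ (fun z => f z • ψp z) (fun z => f z • ψm z) :=
  ⟨hf.continuous.continuousOn.smul h.1, hf.differentiableOn.smul h.2,
    hf.continuous.continuousOn.smul h.3, hf.differentiableOn.smul h.4,
    fun l => by rw [h.jump, Matrix.mulVec_smul]⟩

end LinSol

section jump

variable {R : (Fin 2 → ℂ) → (Fin 2 → ℂ)}

theorem jacobian_mulVec (R : (Fin 2 → ℂ) → (Fin 2 → ℂ)) (ξ w : Fin 2 → ℂ) :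
    jacobian R ξ *ᵥ w = fderiv ℂ R ξ w := by
  conv_rhs => rw [← Finset.univ_sum_single w, map_sum]
  funext m
  simp only [Matrix.mulVec, dotProduct, jacobian, Matrix.of_apply, Finset.sum_apply]
  refine Finset.sum_congr rfl fun n _ => ?_
  have : (Pi.single n (w n) : Fin 2 → ℂ) = w n • Pi.single n 1 := by
    rw [← Pi.single_smul]; simp
  rw [this, map_smul]
  simp [mul_comm]

/-- The chain rule along a real parameter, which may be `x`, `y`, `t` or real `λ`. -/
theorem jump_deriv (hR : Differentiable ℂ R) {a b : ℝ → Fin 2 → ℂ} {a' b' : Fin 2 → ℂ} {s : ℝ}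
    (ha : ∀ i, HasDerivAt (fun s => a s i) (a' i) s)
    (hb : ∀ i, HasDerivAt (fun s => b s i) (b' i) s)
    (h : ∀ᶠ s in 𝓝 s, a s = R (b s)) : a' = jacobian R (b s) *ᵥ b' := by
  have ha' : HasDerivAt a a' s := hasDerivAt_pi.2 ha
  have hb' : HasDerivAt b b' s := hasDerivAt_pi.2 hb
  have hR' := ((hR (b s)).hasFDerivAt.restrictScalars ℝ).comp_hasDerivAt s hb'
  rw [jacobian_mulVec]
  exact ha'.unique (hR'.congr_of_eventuallyEq h)

end jump

section solution

variable {Ω : Set (ℝ × ℝ × ℝ)} {H : Set ℂ} {u v : Field} {π : Wave} {x y t : ℝ} {z : ℂ}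

theorem IsNormalized.nice (h : IsNormalized Ω H u v π) (i : Fin 2) :
    Nice Ω H (fun q => π q.1 q.2.1 q.2.2.1 q.2.2.2 i) :=
  ⟨h.smooth i, fun x y t hp => h.holomorphic x y t hp i⟩

section

variable (h : IsNormalized Ω H u v π) (hΩ : IsOpen Ω) (hH : IsHalfPlane H)
  (hp : (x, y, t) ∈ Ω)

include h hΩ hp

theorem IsNormalized.wx_eq (hz : z ∈ H) (i : Fin 2) : wx π x y t z i =
    pd Ω H ex (fun q => π q.1 q.2.1 q.2.2.1 q.2.2.2 i) (x, y, t, z) :=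
  (hasDerivAt_x hΩ (h.smooth i) hp hz).deriv

theorem IsNormalized.wy_eq (hz : z ∈ H) (i : Fin 2) : wy π x y t z i =
    pd Ω H ey (fun q => π q.1 q.2.1 q.2.2.1 q.2.2.2 i) (x, y, t, z) :=
  (hasDerivAt_y hΩ (h.smooth i) hp hz).deriv

theorem IsNormalized.wt_eq (hz : z ∈ H) (i : Fin 2) : wt π x y t z i =
    pd Ω H et (fun q => π q.1 q.2.1 q.2.2.1 q.2.2.2 i) (x, y, t, z) :=
  (hasDerivAt_t hΩ (h.smooth i) hp hz).deriv

include hH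

theorem IsNormalized.wz_eq (hz : z ∈ H) (i : Fin 2) : wz H π x y t z i =
    pd Ω H ez (fun q => π q.1 q.2.1 q.2.2.1 q.2.2.2 i) (x, y, t, z) :=
  ((h.nice i).hasDerivWithinAt hΩ hH hp hz).derivWithin (hH.uniqueDiffOn z hz)

theorem IsNormalized.continuousOn_of_eq {w : ℂ → Fin 2 → ℂ} {e : ℝ × ℝ × ℝ × ℂ}
    (hw : ∀ z ∈ H, ∀ i, w z i =
      pd Ω H e (fun q => π q.1 q.2.1 q.2.2.1 q.2.2.2 i) (x, y, t, z)) :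
    ContinuousOn w H :=
  continuousOn_pi.2 fun i => (continuousOn_pd hΩ hH (h.smooth i) e hp).congr
    fun z hz => hw z hz i

theorem IsNormalized.differentiableOn_of_eq {w : ℂ → Fin 2 → ℂ} {e : ℝ × ℝ × ℝ × ℂ}
    (hw : ∀ z ∈ H, ∀ i, w z i =
      pd Ω H e (fun q => π q.1 q.2.1 q.2.2.1 q.2.2.2 i) (x, y, t, z)) :
    DifferentiableOn ℂ w (interior H) :=
  differentiableOn_pi.2 fun i => (((h.nice i).pd hΩ hH e).hol x y t hp).congr
    fun z hz => hw z (interior_subset hz) i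

end

variable {R : (Fin 2 → ℂ) → (Fin 2 → ℂ)} {πp πm : Wave}

theorem IsSolution.linSol_of_eq (hsol : IsSolution Ω R u v πp πm) (hΩ : IsOpen Ω)
    (hp : (x, y, t) ∈ Ω) {wp wm : ℂ → Fin 2 → ℂ} (e : ℝ × ℝ × ℝ × ℂ)
    (hwp : ∀ z ∈ upper, ∀ i, wp z i =
      pd Ω upper e (fun q => πp q.1 q.2.1 q.2.2.1 q.2.2.2 i) (x, y, t, z))
    (hwm : ∀ z ∈ lower, ∀ i, wm z i =
      pd Ω lower e (fun q => πm q.1 q.2.1 q.2.2.1 q.2.2.2 i) (x, y, t, z))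
    (hj : ∀ l : ℝ, wp l = jacobian R (πm x y t l) *ᵥ wm l) : LinSol R (πm x y t) wp wm :=
  ⟨hsol.plus.continuousOn_of_eq hΩ isHalfPlane_upper hp hwp,
   hsol.plus.differentiableOn_of_eq hΩ isHalfPlane_upper hp hwp,
   hsol.minus.continuousOn_of_eq hΩ isHalfPlane_lower hp hwm,
   hsol.minus.differentiableOn_of_eq hΩ isHalfPlane_lower hp hwm, hj⟩

section

variable (hsol : IsSolution Ω R u v πp πm) (hR : Differentiable ℂ R) (hΩ : IsOpen Ω)
  (hp : (x, y, t) ∈ Ω)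

include hsol hR hΩ hp

theorem IsSolution.linSol_wx : LinSol R (πm x y t) (wx πp x y t) (wx πm x y t) :=
  hsol.linSol_of_eq hΩ hp ex (fun _ hz i => hsol.plus.wx_eq hΩ hp hz i)
    (fun _ hz i => hsol.minus.wx_eq hΩ hp hz i) fun l =>
    jump_deriv hR (a := fun s => πp s y t l) (b := fun s => πm s y t l)
      (fun i => (hasDerivAt_x hΩ (hsol.plus.smooth i) hp
        (isHalfPlane_upper.ofReal_mem l)).differentiableAt.hasDerivAt)
      (fun i => (hasDerivAt_x hΩ (hsol.minus.smooth i) hp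
        (isHalfPlane_lower.ofReal_mem l)).differentiableAt.hasDerivAt)
      ((eventually_x hΩ hp).mono fun _ hs => hsol.jump _ _ _ hs l)

theorem IsSolution.linSol_wy : LinSol R (πm x y t) (wy πp x y t) (wy πm x y t) :=
  hsol.linSol_of_eq hΩ hp ey (fun _ hz i => hsol.plus.wy_eq hΩ hp hz i)
    (fun _ hz i => hsol.minus.wy_eq hΩ hp hz i) fun l =>
    jump_deriv hR (a := fun s => πp x s t l) (b := fun s => πm x s t l)
      (fun i => (hasDerivAt_y hΩ (hsol.plus.smooth i) hp
        (isHalfPlane_upper.ofReal_mem l)).differentiableAt.hasDerivAt)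
      (fun i => (hasDerivAt_y hΩ (hsol.minus.smooth i) hp
        (isHalfPlane_lower.ofReal_mem l)).differentiableAt.hasDerivAt)
      ((eventually_y hΩ hp).mono fun _ hs => hsol.jump _ _ _ hs l)

theorem IsSolution.linSol_wt : LinSol R (πm x y t) (wt πp x y t) (wt πm x y t) :=
  hsol.linSol_of_eq hΩ hp et (fun _ hz i => hsol.plus.wt_eq hΩ hp hz i)
    (fun _ hz i => hsol.minus.wt_eq hΩ hp hz i) fun l =>
    jump_deriv hR (a := fun s => πp x y s l) (b := fun s => πm x y s l)
      (fun i => (hasDerivAt_t hΩ (hsol.plus.smooth i) hp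
        (isHalfPlane_upper.ofReal_mem l)).differentiableAt.hasDerivAt)
      (fun i => (hasDerivAt_t hΩ (hsol.minus.smooth i) hp
        (isHalfPlane_lower.ofReal_mem l)).differentiableAt.hasDerivAt)
      ((eventually_t hΩ hp).mono fun _ hs => hsol.jump _ _ _ hs l)

-- At a real point the derivative within `H` can be computed along the real axis, the only direction
-- in which the jump relation can be differentiated.
omit hsol hR in
theorem IsNormalized.hasDerivAt_real (h : IsNormalized Ω H u v π) (hH : IsHalfPlane H) (l : ℝ)
    (i : Fin 2) : HasDerivAt (fun s : ℝ => π x y t s i) (wz H π x y t l i) l := by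
  have h1 := ((h.nice i).hasDerivWithinAt hΩ hH hp (hH.ofReal_mem l))
  rw [← h.wz_eq hΩ hH hp (hH.ofReal_mem l)] at h1
  have h2 := (h1.hasFDerivWithinAt.restrictScalars ℝ).comp_hasDerivAt (f := fun s : ℝ => (s : ℂ))
    l Complex.ofRealCLM.hasDerivAt (.of_forall hH.ofReal_mem)
  simpa [Function.comp_def] using h2

theorem IsSolution.linSol_wz :
    LinSol R (πm x y t) (wz upper πp x y t) (wz lower πm x y t) :=
  hsol.linSol_of_eq hΩ hp ez (fun _ hz i => hsol.plus.wz_eq hΩ isHalfPlane_upper hp hz i)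
    (fun _ hz i => hsol.minus.wz_eq hΩ isHalfPlane_lower hp hz i) fun l =>
    jump_deriv hR (a := fun s => πp x y t s) (b := fun s => πm x y t s)
      (fun i => hsol.plus.hasDerivAt_real hΩ hp isHalfPlane_upper l i)
      (fun i => hsol.minus.hasDerivAt_real hΩ hp isHalfPlane_lower l i)
      (.of_forall fun s => hsol.jump _ _ _ hp s)

theorem IsSolution.linSol_lax₁ :
    LinSol R (πm x y t) (lax₁ u upper πp x y t) (lax₁ u lower πm x y t) := by
  rw [lax₁_eq, lax₁_eq]
  exact ((hsol.linSol_wy hR hΩ hp).add ((hsol.linSol_wx hR hΩ hp).smul (by fun_prop))).add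
    ((hsol.linSol_wz hR hΩ hp).smul (by fun_prop))

theorem IsSolution.linSol_lax₂ :
    LinSol R (πm x y t) (lax₂ u upper πp x y t) (lax₂ u lower πm x y t) := by
  rw [lax₂_eq, lax₂_eq]
  exact ((hsol.linSol_wt hR hΩ hp).add ((hsol.linSol_wx hR hΩ hp).smul (by fun_prop))).add
    ((hsol.linSol_wz hR hΩ hp).smul (by fun_prop))

end

end solution

/-! ### Vanishing of bounded solutions of the linearised problem -/

/-- Asymptotic behaviour along `l` of `π` and of two tangent vectors `α`, `β`. -/
structure Frame (l : Filter ℂ) (y t : ℝ) (c : ℂ) (π α β : ℂ → Fin 2 → ℂ) : Prop where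
  base : Filter.Tendsto (fun z => z⁻¹ * π z 0) l (𝓝 1)
  fst_zero : Filter.Tendsto (fun z => α z 0) l (𝓝 1)
  fst_defect : Filter.Tendsto (fun z => defect y t π α z) l (𝓝 0)
  snd_zero : Filter.Tendsto (fun z => z * β z 0) l (𝓝 c)
  snd_defect : Filter.Tendsto (fun z => defect y t π β z) l (𝓝 1)

/-- Tangent vectors `X` with `λ X₁ → C` and vanishing defect. -/
structure Small (l : Filter ℂ) (y t : ℝ) (C : ℂ) (π X : ℂ → Fin 2 → ℂ) : Prop where
  zero : Filter.Tendsto (fun z => z * X z 0) l (𝓝 C)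
  defect : Filter.Tendsto (fun z => defect y t π X z) l (𝓝 0)

section vanishing

variable {H : Set ℂ} {y t : ℝ} {c C : ℂ} {π α β X : ℂ → Fin 2 → ℂ}

theorem tendsto_zero_of_mul {f : ℂ → ℂ} (h : Filter.Tendsto (fun z => z * f z) (atInf H) (𝓝 C)) :
    Filter.Tendsto f (atInf H) (𝓝 0) := by
  have := tendsto_inv_atInf.mul h
  rw [zero_mul] at this
  refine this.congr' ?_
  filter_upwards [eventually_atInf] with z hz
  rw [inv_mul_cancel_left₀ hz.2]

/-- The second component is the defect plus `(y - tπ₁)X₁`. Since `π₁ ~ λ` and `λX₁ → C`, the last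
product tends to `-tC`. -/
theorem tendsto_of_defect {K D : ℂ}
    (hπ : Filter.Tendsto (fun z => z⁻¹ * π z 0) (atInf H) (𝓝 1))
    (h0 : Filter.Tendsto (fun z => z * X z 0) (atInf H) (𝓝 C))
    (h1 : Filter.Tendsto (fun z => defect y t π X z) (atInf H) (𝓝 D)) (hK : D - t * C = K) :
    Filter.Tendsto X (atInf H) (𝓝 ![0, K]) := by
  have hX0 := tendsto_zero_of_mul h0
  refine tendsto_pi_nhds.2 fun i => ?_
  fin_cases i
  · simpa using hX0
  · have h2 := h1.add ((hX0.const_mul (y : ℂ)).sub ((hπ.mul h0).const_mul (t : ℂ)))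
    have e : D + (y * 0 - t * (1 * C)) = K := by rw [← hK]; ring
    rw [e] at h2
    refine h2.congr' ?_
    filter_upwards [eventually_atInf] with z hz
    have := hz.2
    simp only [defect]
    field_simp
    simp only [Fin.mk_one]
    ring

/-- A determinant of two tangent vectors does not change when second components are replaced by
defects, a shear. The individual entries then have known limits. -/
theorem Frame.det (hH : IsHalfPlane H) (f : Frame (atInf H) y t c π α β)
    (hX : Small (atInf H) y t C π X) :
    Filter.Tendsto (fun l : ℝ => α l 0 * β l 1 - α l 1 * β l 0) Filter.atTop (𝓝 1) ∧
    Filter.Tendsto (fun l : ℝ => l * (X l 0 * β l 1 - X l 1 * β l 0)) Filter.atTop (𝓝 C) ∧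
    Filter.Tendsto (fun l : ℝ => α l 0 * X l 1 - α l 1 * X l 0) Filter.atTop (𝓝 0) := by
  have hβ := tendsto_zero_of_mul f.snd_zero
  have hX0 := tendsto_zero_of_mul hX.zero
  refine ⟨?_, ?_, ?_⟩
  · have := ((f.fst_zero.mul f.snd_defect).sub (f.fst_defect.mul hβ)).comp hH.tendsto_ofReal
    simp only [one_mul, zero_mul, sub_zero] at this
    refine this.congr fun l => ?_
    simp only [Function.comp, defect]; ring
  · have := ((hX.zero.mul f.snd_defect).sub (hX.defect.mul f.snd_zero)).comp hH.tendsto_ofReal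
    simp only [mul_one, zero_mul, sub_zero] at this
    refine this.congr fun l => ?_
    simp only [Function.comp, defect]; ring
  · have := ((f.fst_zero.mul hX.defect).sub (f.fst_defect.mul hX0)).comp hH.tendsto_ofReal
    simp only [one_mul, zero_mul, sub_zero] at this
    refine this.congr fun l => ?_
    simp only [Function.comp, defect]; ring

variable {R : (Fin 2 → ℂ) → (Fin 2 → ℂ)} {ξ πp πm αp αm βp βm Xp Xm : ℂ → Fin 2 → ℂ} {Cp Cm : ℂ}

/-- Cramer's rule transported by the jump matrix. -/
theorem LinSol.cramer (ha : LinSol R ξ αp αm) (hb : LinSol R ξ βp βm) (hX : LinSol R ξ Xp Xm)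
    (l : ℝ) : (αm l 0 * βm l 1 - αm l 1 * βm l 0) * Xp l 0 =
      (Xm l 0 * βm l 1 - Xm l 1 * βm l 0) * αp l 0 +
      (αm l 0 * Xm l 1 - αm l 1 * Xm l 0) * βp l 0 := by
  rw [ha.jump, hb.jump, hX.jump]
  simp only [Matrix.mulVec, dotProduct, Fin.sum_univ_two]
  ring

/-- On the real axis the coefficients of `X` in the frame `α, β` are the same on both sides of the
jump. Computed from the minus side they behave like `Cm/λ` and `o(1)`; inserted on the plus side
they give `λX₁ → Cm`. -/
theorem eq_of_small (ha : LinSol R ξ αp αm) (hb : LinSol R ξ βp βm) (hX : LinSol R ξ Xp Xm)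
    (fp : Frame (atInf upper) y t c πp αp βp) (fm : Frame (atInf lower) y t c πm αm βm)
    (sp : Small (atInf upper) y t Cp πp Xp) (sm : Small (atInf lower) y t Cm πm Xm) :
    Cp = Cm := by
  obtain ⟨d1, d2, d3⟩ := fm.det isHalfPlane_lower sm
  have r := isHalfPlane_upper.tendsto_ofReal
  have h1 := d1.mul (sp.zero.comp r)
  have h2 := (d2.mul (fp.fst_zero.comp r)).add (d3.mul (fp.snd_zero.comp r))
  simp only [one_mul, mul_one, zero_mul, add_zero] at h1 h2
  refine tendsto_nhds_unique (h1.congr fun l => ?_) h2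
  have := ha.cramer hb hX l
  simp only [Function.comp]
  linear_combination (l : ℂ) * this

/-- A solution of the linearised problem that is only bounded at infinity, but small in the sense
of `Small`, vanishes. -/
theorem eq_zero_of_small
    (huniq : ∀ ψp ψm, LinSol R ξ ψp ψm → Filter.Tendsto ψp (atInf upper) (𝓝 0) →
      Filter.Tendsto ψm (atInf lower) (𝓝 0) → (∀ z ∈ upper, ψp z = 0) ∧ (∀ z ∈ lower, ψm z = 0))
    (ha : LinSol R ξ αp αm) (hb : LinSol R ξ βp βm) (hX : LinSol R ξ Xp Xm)
    (fp : Frame (atInf upper) y t c πp αp βp) (fm : Frame (atInf lower) y t c πm αm βm)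
    (sp : Small (atInf upper) y t Cp πp Xp) (sm : Small (atInf lower) y t Cm πm Xm) :
    (∀ z ∈ upper, Xp z = 0) ∧ (∀ z ∈ lower, Xm z = 0) := by
  obtain rfl := eq_of_small ha hb hX fp fm sp sm
  -- The limits of `X` and `β` are `(0, -tC)` and `(0, 1 - tc)`; this combination cancels them
  -- without dividing by `1 - tc`, which may be zero.
  have hY := (hX.smul (f := fun _ => 1 - t * c) (by fun_prop)).add
    (hb.smul (f := fun _ => t * Cp) (by fun_prop))
  have aux : ∀ {H : Set ℂ} {π α β X : ℂ → Fin 2 → ℂ}, Frame (atInf H) y t c π α β →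
      Small (atInf H) y t Cp π X →
      Filter.Tendsto (fun z => z * ((1 - t * c) • X z + (t * Cp) • β z) 0) (atInf H) (𝓝 Cp) ∧
      Filter.Tendsto (fun z => (1 - t * c) • X z + (t * Cp) • β z) (atInf H) (𝓝 0) := by
    intro H π α β X f s
    have h0 : Filter.Tendsto (fun z => z * ((1 - t * c) • X z + (t * Cp) • β z) 0) (atInf H)
        (𝓝 Cp) := by
      have := (s.zero.const_mul (1 - t * c)).add (f.snd_zero.const_mul (t * Cp))
      rw [show (1 - t * c) * Cp + t * Cp * c = Cp by ring] at this
      refine this.congr fun z => ?_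
      simp only [Pi.add_apply, Pi.smul_apply, smul_eq_mul]; ring
    refine ⟨h0, ?_⟩
    have h1 : Filter.Tendsto (fun z => defect y t π
        (fun z => (1 - t * c) • X z + (t * Cp) • β z) z) (atInf H) (𝓝 (t * Cp)) := by
      have := (s.defect.const_mul (1 - t * c)).add (f.snd_defect.const_mul (t * Cp))
      rw [show (1 - t * c) * 0 + t * Cp * 1 = t * Cp by ring] at this
      refine this.congr fun z => ?_
      simp only [defect, Pi.add_apply, Pi.smul_apply, smul_eq_mul]; ring
    have := tendsto_of_defect f.base h0 h1 (sub_self _)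
    convert this using 2
    ext i; fin_cases i <;> rfl
  have hz := (huniq _ _ hY (aux fp sp).2 (aux fm sm).2).1
  have := isHalfPlane_upper.neBot_atInf
  -- The first component of the combination still satisfies `λY₁ → (1 - tc)C + tCc = C`, while `Y =
  -- 0`.
  have hC : Cp = 0 := by
    refine tendsto_nhds_unique (aux fp sp).1 (tendsto_const_nhds.congr' ?_)
    filter_upwards [eventually_atInf] with z h
    rw [hz z h.1]; simp
  subst hC
  have e : (0 : Fin 2 → ℂ) = ![0, 0] := by ext i; fin_cases i <;> rfl
  refine huniq _ _ hX ?_ ?_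
  · rw [e]; exact tendsto_of_defect fp.base sp.zero sp.defect (by ring)
  · rw [e]; exact tendsto_of_defect fm.base sm.zero sm.defect (by ring)

end vanishing

/-! ### Asymptotics of the frame `π_λ`, `π_x - 2u_x π_λ` -/

namespace Expansion

variable {Ω : Set (ℝ × ℝ × ℝ)} {H : Set ℂ} {u v : Field} {π : Wave}
  {g ρ : ℝ × ℝ × ℝ × ℂ → ℂ} {x y t : ℝ} {z : ℂ}
  (h : Expansion Ω H u v π g ρ) (hΩ : IsOpen Ω) (hH : IsHalfPlane H)
  (hv : FieldSmooth Ω v) (hp : (x, y, t) ∈ Ω)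

include h hΩ hH hp

section

include hv

theorem pd_x_g : pd Ω (conjSet H) ex g (x, y, t, 0) = 2 * dx (dy v) x y t := by
  refine (hasDerivAt_x hΩ h.nice_g.smooth hp hH.conj.zero_mem).unique ?_
  refine (((hv.dy hΩ).hasDerivAt_x hΩ hp).const_mul 2).congr_of_eventuallyEq ?_
  filter_upwards [eventually_x hΩ hp] with s hs using h.g_zero _ _ _ hs

theorem pd_y_g : pd Ω (conjSet H) ey g (x, y, t, 0) = 2 * dy (dy v) x y t := by
  refine (hasDerivAt_y hΩ h.nice_g.smooth hp hH.conj.zero_mem).unique ?_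
  refine (((hv.dy hΩ).hasDerivAt_y hΩ hp).const_mul 2).congr_of_eventuallyEq ?_
  filter_upwards [eventually_y hΩ hp] with s hs using h.g_zero _ _ _ hs

theorem pd_z_x_ρ : pd Ω (conjSet H) ez (pd Ω (conjSet H) ex ρ) (x, y, t, 0) =
    2 * dx v x y t := by
  rw [pd_comm hΩ hH.conj h.nice_ρ.smooth _ _ ⟨hp, hH.conj.zero_mem⟩]
  refine (hasDerivAt_x hΩ (pd_smooth hΩ hH.conj h.nice_ρ.smooth ez) hp
    hH.conj.zero_mem).unique ?_
  refine ((hv.hasDerivAt_x hΩ hp).const_mul 2).congr_of_eventuallyEq ?_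
  filter_upwards [eventually_x hΩ hp] with s hs using h.ρ_one _ _ _ hs

theorem pd_z_y_ρ : pd Ω (conjSet H) ez (pd Ω (conjSet H) ey ρ) (x, y, t, 0) =
    2 * dy v x y t := by
  rw [pd_comm hΩ hH.conj h.nice_ρ.smooth _ _ ⟨hp, hH.conj.zero_mem⟩]
  refine (hasDerivAt_y hΩ (pd_smooth hΩ hH.conj h.nice_ρ.smooth ez) hp
    hH.conj.zero_mem).unique ?_
  refine ((hv.hasDerivAt_y hΩ hp).const_mul 2).congr_of_eventuallyEq ?_
  filter_upwards [eventually_y hΩ hp] with s hs using h.ρ_one _ _ _ hs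

end

theorem pd_x_ρ : pd Ω (conjSet H) ex ρ (x, y, t, 0) = 0 := by
  refine (hasDerivAt_x hΩ h.nice_ρ.smooth hp hH.conj.zero_mem).unique ?_
  refine (hasDerivAt_const x (0 : ℂ)).congr_of_eventuallyEq ?_
  filter_upwards [eventually_x hΩ hp] with s hs using h.ρ_zero _ _ _ hs

theorem pd_y_ρ : pd Ω (conjSet H) ey ρ (x, y, t, 0) = 0 := by
  refine (hasDerivAt_y hΩ h.nice_ρ.smooth hp hH.conj.zero_mem).unique ?_
  refine (hasDerivAt_const y (0 : ℂ)).congr_of_eventuallyEq ?_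
  filter_upwards [eventually_y hΩ hp] with s hs using h.ρ_zero _ _ _ hs

theorem pd_t_ρ : pd Ω (conjSet H) et ρ (x, y, t, 0) = 0 := by
  refine (hasDerivAt_t hΩ h.nice_ρ.smooth hp hH.conj.zero_mem).unique ?_
  refine (hasDerivAt_const t (0 : ℂ)).congr_of_eventuallyEq ?_
  filter_upwards [eventually_t hΩ hp] with s hs using h.ρ_zero _ _ _ hs

theorem tendsto_pd_g (e : ℝ × ℝ × ℝ × ℂ) :
    Filter.Tendsto (fun z => pd Ω (conjSet H) e g (x, y, t, z⁻¹)) (atInf H)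
      (𝓝 (pd Ω (conjSet H) e g (x, y, t, 0))) :=
  tendsto_slice hH (pd_smooth hΩ hH.conj h.nice_g.smooth e) hp

theorem tendsto_pd_ρ (e : ℝ × ℝ × ℝ × ℂ) :
    Filter.Tendsto (fun z => pd Ω (conjSet H) e ρ (x, y, t, z⁻¹)) (atInf H)
      (𝓝 (pd Ω (conjSet H) e ρ (x, y, t, 0))) :=
  tendsto_slice hH (pd_smooth hΩ hH.conj h.nice_ρ.smooth e) hp

omit hΩ in
theorem tendsto_base : Filter.Tendsto (fun z => z⁻¹ * π x y t z 0) (atInf H) (𝓝 1) := by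
  have i := tendsto_inv_atInf (H := H)
  have := ((i.const_mul (2 * u x y t)).const_add 1).add
    ((i.mul i).mul (tendsto_slice hH h.nice_g.smooth hp))
  simp only [mul_zero, zero_mul, add_zero] at this
  refine this.congr' ?_
  filter_upwards [eventually_atInf] with z hz
  have := hz.2
  rw [h.eq_zero x y t hp z hz.1 hz.2]
  field_simp

theorem tendsto_wz_zero : Filter.Tendsto (fun z => wz H π x y t z 0) (atInf H) (𝓝 1) := by
  have i := tendsto_inv_atInf (H := H)
  have := ((i.pow 2).mul ((tendsto_slice hH h.nice_g.smooth hp).add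
    (i.mul (h.tendsto_pd_g hΩ hH hp ez)))).const_sub 1
  simp only [ne_eq, OfNat.ofNat_ne_zero, not_false_eq_true, zero_pow, zero_mul, sub_zero] at this
  refine this.congr' ?_
  filter_upwards [eventually_atInf] with z hz
  rw [h.wz_zero hΩ hH hp hz.1 hz.2]

theorem tendsto_mul_defect_wz :
    Filter.Tendsto (fun z => z * defect y t (π x y t) (wz H π x y t) z) (atInf H) (𝓝 0) := by
  have i := tendsto_inv_atInf (H := H)
  have := (i.mul (h.tendsto_pd_ρ hΩ hH hp ez)).neg
  simp only [zero_mul, neg_zero] at this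
  refine this.congr' ?_
  filter_upwards [eventually_atInf] with z hz
  have := hz.2
  rw [h.defect_wz hΩ hH hp hz.1 hz.2]
  field_simp

variable (hu : FieldSmooth Ω u)

include hu in
theorem tendsto_defect_wx :
    Filter.Tendsto (fun z => defect y t (π x y t) (wx π x y t) z) (atInf H) (𝓝 1) := by
  have := (h.tendsto_pd_ρ hΩ hH hp ex).const_add 1
  rw [h.pd_x_ρ hΩ hH hp, add_zero] at this
  refine this.congr' ?_
  filter_upwards [eventually_atInf] with z hz
  rw [h.defect_wx hΩ hH hu hp hz.1 hz.2]

-- Subtracting `2u_x π_λ` removes the limit `2u_x` of the first component of `π_x`. The next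
-- coefficient is `g_x = 2v_xy = 2u_y` at `μ = 0`, which depends on `u` alone and so agrees in both
-- half planes.
include hv hu in
theorem frame (hvx : ∀ x y t, (x, y, t) ∈ Ω → dx v x y t = u x y t) :
    Frame (atInf H) y t (2 * dy u x y t) (π x y t) (wz H π x y t)
      (fun z => wx π x y t z + (-(2 * dx u x y t)) • wz H π x y t z) := by
  have i := tendsto_inv_atInf (H := H)
  have d0 := tendsto_zero_of_mul (h.tendsto_mul_defect_wz hΩ hH hp)
  refine ⟨h.tendsto_base hH hp, h.tendsto_wz_zero hΩ hH hp, d0, ?_, ?_⟩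
  · have := (h.tendsto_pd_g hΩ hH hp ex).add ((i.mul ((tendsto_slice hH h.nice_g.smooth hp).add
      (i.mul (h.tendsto_pd_g hΩ hH hp ez)))).const_mul (2 * dx u x y t))
    rw [zero_mul, mul_zero, add_zero, h.pd_x_g hΩ hH hv hp, hv.dx_dy hΩ hp,
      FieldSmooth.congr_deriv_y hΩ hvx hp] at this
    refine this.congr' ?_
    filter_upwards [eventually_atInf] with z hz
    have := hz.2
    simp only [Pi.add_apply, Pi.smul_apply, smul_eq_mul]
    rw [h.wz_zero hΩ hH hp hz.1 hz.2, h.wx_zero hΩ hH hu hp hz.1 hz.2]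
    field_simp
    ring
  · have := (h.tendsto_defect_wx hΩ hH hp hu).add (d0.const_mul (-(2 * dx u x y t)))
    rw [mul_zero, add_zero] at this
    refine this.congr fun z => ?_
    simp only [defect, Pi.add_apply, Pi.smul_apply, smul_eq_mul]
    ring

end Expansion

/-! ### Asymptotics of `L₁π` and `L₂π` -/

section lax

variable {Ω : Set (ℝ × ℝ × ℝ)} {H : Set ℂ} {u v : Field} {π : Wave} {x y t : ℝ} {z : ℂ}

theorem defect_lax₁ : defect y t (π x y t) (lax₁ u H π x y t) z =
    defect y t (π x y t) (wy π x y t) z - z * defect y t (π x y t) (wx π x y t) z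
      + 2 * dx u x y t * z * defect y t (π x y t) (wz H π x y t) z := by
  simp only [defect, lax₁, wx, wy, wz]; ring

theorem defect_lax₂ : defect y t (π x y t) (lax₂ u H π x y t) z =
    defect y t (π x y t) (wt π x y t) z
      + (1 / 2 * z ^ 2 + u x y t * z) * defect y t (π x y t) (wx π x y t) z
      - (dx u x y t * z + dy u x y t + 2 * u x y t * dx u x y t) * z
        * defect y t (π x y t) (wz H π x y t) z := by
  simp only [defect, lax₂, wx, wt, wz]; ring

namespace Expansion

variable {g ρ : ℝ × ℝ × ℝ × ℂ → ℂ}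
  (h : Expansion Ω H u v π g ρ) (hΩ : IsOpen Ω) (hH : IsHalfPlane H)
  (hv : FieldSmooth Ω v) (hu : FieldSmooth Ω u) (hp : (x, y, t) ∈ Ω)

include h hΩ hH hv hu hp

/-- In the first component the terms `2u_x λ` cancel, and so do the constants `2u_y` and `g_x =
2v_xy`. The defect tends to `2u - ρ_xμ = 2u - 2v_x = 0`. -/
theorem small_lax₁ (hvx : ∀ x y t, (x, y, t) ∈ Ω → dx v x y t = u x y t) :
    ∃ C, Small (atInf H) y t C (π x y t) (lax₁ u H π x y t) := by
  have i := tendsto_inv_atInf (H := H)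
  have hg := tendsto_slice hH h.nice_g.smooth hp
  have nF := ((h.nice_g.pd hΩ hH.conj ex).sub (Nice.const (2 * dy u x y t)))
  have l1 := tendsto_mul_slice hΩ hH nF hp (by
    rw [h.pd_x_g hΩ hH hv hp, hv.dx_dy hΩ hp, FieldSmooth.congr_deriv_y hΩ hvx hp, sub_self])
  have l2 := (h.tendsto_pd_g hΩ hH hp ey).sub ((hg.add
    (i.mul (h.tendsto_pd_g hΩ hH hp ez))).const_mul (2 * dx u x y t))
  refine ⟨_, (l2.sub l1).congr' ?_, ?_⟩
  · filter_upwards [eventually_atInf] with z hz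
    have := hz.2
    change _ = z * (wy π x y t z 0 - z * wx π x y t z 0 + 2 * dx u x y t * z * wz H π x y t z 0)
    rw [h.wz_zero hΩ hH hp hz.1 hz.2, h.wx_zero hΩ hH hu hp hz.1 hz.2,
      h.wy_zero hΩ hH hu hp hz.1 hz.2]
    field_simp
    ring
  · have l3 := tendsto_mul_slice hΩ hH (h.nice_ρ.pd hΩ hH.conj ex) hp (h.pd_x_ρ hΩ hH hp)
    have l4 := ((((i.mul hg).const_add (2 * u x y t)).add (h.tendsto_pd_ρ hΩ hH hp ey)).sub l3).add
      ((h.tendsto_mul_defect_wz hΩ hH hp).const_mul (2 * dx u x y t))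
    rw [h.pd_z_x_ρ hΩ hH hv hp, hvx x y t hp, h.pd_y_ρ hΩ hH hp] at l4
    simp only [zero_mul, mul_zero, add_zero, sub_self] at l4
    refine l4.congr' ?_
    filter_upwards [eventually_atInf] with z hz
    rw [defect_lax₁, h.defect_wy hΩ hH hu hp hz.1 hz.2, h.defect_wx hΩ hH hu hp hz.1 hz.2,
      h.eq_zero x y t hp z hz.1 hz.2]
    ring

/-- Using `L₁π = 0` to eliminate `π_x` leaves `L₂π = π_t + (λ/2 + u)π_y - u_y λ π_λ`. The first
component of this tends to the coefficient subtracted here with `π_λ`. -/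
theorem small_lax₂ (hL : ∀ z ∈ H, lax₁ u H π x y t z = 0) :
    ∃ C, Small (atInf H) y t C (π x y t) (fun z => lax₂ u H π x y t z
      + (-(2 * dt u x y t + dy (dy v) x y t + 2 * u x y t * dy u x y t)) • wz H π x y t z) := by
  have i := tendsto_inv_atInf (H := H)
  have hg := tendsto_slice hH h.nice_g.smooth hp
  have hG := hg.add (i.mul (h.tendsto_pd_g hΩ hH hp ez))
  have nF := ((h.nice_g.pd hΩ hH.conj ey).sub (Nice.const (2 * dy (dy v) x y t)))
  have l1 := tendsto_mul_slice hΩ hH nF hp (by rw [h.pd_y_g hΩ hH hv hp, sub_self])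
  have l2 := ((((l1.const_mul (1 / 2)).add (h.tendsto_pd_g hΩ hH hp et)).add
    ((h.tendsto_pd_g hΩ hH hp ey).const_mul (u x y t))).add (hG.const_mul (dy u x y t))).add
    ((i.mul hG).const_mul (2 * dt u x y t + dy (dy v) x y t + 2 * u x y t * dy u x y t))
  refine ⟨_, l2.congr' ?_, ?_⟩
  · filter_upwards [eventually_atInf] with z hz
    have h0 := hz.2
    have e1 : wy π x y t z 0 - z * wx π x y t z 0 + 2 * dx u x y t * z * wz H π x y t z 0 = 0 :=
      congrFun (hL z hz.1) 0
    have e2 : lax₂ u H π x y t z 0 = wt π x y t z 0 + (1 / 2 * z + u x y t) * wy π x y t z 0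
        - dy u x y t * z * wz H π x y t z 0 := by
      change wt π x y t z 0 + (1 / 2 * z ^ 2 + u x y t * z) * wx π x y t z 0
        - (dx u x y t * z + dy u x y t + 2 * u x y t * dx u x y t) * z * wz H π x y t z 0 = _
      linear_combination -(1 / 2 * z + u x y t) * e1
    simp only [Pi.add_apply, Pi.smul_apply, smul_eq_mul]
    rw [e2, h.wz_zero hΩ hH hp hz.1 hz.2, h.wt_zero hΩ hH hu hp hz.1 hz.2,
      h.wy_zero hΩ hH hu hp hz.1 hz.2]
    field_simp
    ring
  · have l3 := tendsto_mul_slice hΩ hH (h.nice_ρ.pd hΩ hH.conj ey) hp (h.pd_y_ρ hΩ hH hp)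
    have l4 := (((((h.tendsto_base hH hp).mul hg).const_mul (-(1 / 2))).add
      (l3.const_mul (1 / 2))).add (h.tendsto_pd_ρ hΩ hH hp et)).add
      ((h.tendsto_pd_ρ hΩ hH hp ey).const_mul (u x y t))
    have l5 := (l4.add ((h.tendsto_mul_defect_wz hΩ hH hp).const_mul (-(dy u x y t)))).add
      ((tendsto_zero_of_mul (h.tendsto_mul_defect_wz hΩ hH hp)).const_mul
        (-(2 * dt u x y t + dy (dy v) x y t + 2 * u x y t * dy u x y t)))
    rw [h.pd_z_y_ρ hΩ hH hv hp, h.pd_y_ρ hΩ hH hp, h.pd_t_ρ hΩ hH hp, h.g_zero x y t hp] at l5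
    -- The quadratic terms in `π₁` contribute `-g/2 = -v_y`, and `(λ/2)ρ_y` contributes `v_y`.
    rw [show -(1 / 2) * (1 * (2 * dy v x y t)) + 1 / 2 * (2 * dy v x y t) + 0 + u x y t * 0
      + -dy u x y t * 0 + -(2 * dt u x y t + dy (dy v) x y t + 2 * u x y t * dy u x y t) * 0
      = (0 : ℂ) by ring] at l5
    refine l5.congr' ?_
    filter_upwards [eventually_atInf] with z hz
    have h0 := hz.2
    have e1 : defect y t (π x y t) (lax₁ u H π x y t) z = 0 := by
      simp [defect, hL z hz.1]
    rw [defect_lax₁] at e1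
    have e2 : defect y t (π x y t) (lax₂ u H π x y t) z =
        defect y t (π x y t) (wt π x y t) z
        + (1 / 2 * z + u x y t) * defect y t (π x y t) (wy π x y t) z
        - dy u x y t * z * defect y t (π x y t) (wz H π x y t) z := by
      rw [defect_lax₂]
      linear_combination -(1 / 2 * z + u x y t) * e1
    have e3 : defect y t (π x y t) (fun z => lax₂ u H π x y t z
      + (-(2 * dt u x y t + dy (dy v) x y t + 2 * u x y t * dy u x y t)) • wz H π x y t z) z =
        defect y t (π x y t) (lax₂ u H π x y t) z
        + (-(2 * dt u x y t + dy (dy v) x y t + 2 * u x y t * dy u x y t))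
          * defect y t (π x y t) (wz H π x y t) z := by
      simp only [defect, Pi.add_apply, Pi.smul_apply, smul_eq_mul]; ring
    have e4 : -(1 / 2) * (z⁻¹ * π x y t z 0 * g (x, y, t, z⁻¹)) =
        π x y t z 0 * (1 / 2 * z + u x y t - 1 / 2 * π x y t z 0) := by
      rw [h.eq_zero x y t hp z hz.1 hz.2]; ring
    rw [e3, e2, h.defect_wy hΩ hH hu hp hz.1 hz.2, h.defect_wt hΩ hH hu hp hz.1 hz.2, e4]
    ring

end Expansion

/-! ### Compatibility of the two operators -/

section commutator

variable {E : Field}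

/-- The commutator of `L₁` and `L₂ - E ∂_λ`, applied to a common null vector. -/
theorem IsNormalized.commutator (h : IsNormalized Ω H u v π) (hΩ : IsOpen Ω)
    (hH : IsHalfPlane H) (hu : FieldSmooth Ω u) (hE : FieldSmooth Ω E)
    (h₁ : ∀ x y t, (x, y, t) ∈ Ω → ∀ z ∈ H, lax₁ u H π x y t z = 0)
    (h₂ : ∀ x y t, (x, y, t) ∈ Ω → ∀ z ∈ H, lax₂ u H π x y t z
      + (-E x y t) • wz H π x y t z = 0) (hp : (x, y, t) ∈ Ω) (hz : z ∈ H) (i : Fin 2) :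
    -E x y t * wx π x y t z i + ((dx E x y t - (2 * dt (dx u) x y t + dy (dy u) x y t
      + dy (dx fun x y t => u x y t ^ 2) x y t)) * z + (2 * E x y t * dx u x y t - dy E x y t))
      * wz H π x y t z i = 0 := by
  set F : ℝ × ℝ × ℝ × ℂ → ℂ := fun q => π q.1 q.2.1 q.2.2.1 q.2.2.2 i
  have nF : Nice Ω H F := h.nice i
  have P : ∀ x y t, (x, y, t) ∈ Ω → ∀ z ∈ H, pd Ω H ey F (x, y, t, z)
      - z * pd Ω H ex F (x, y, t, z) + 2 * dx u x y t * z * pd Ω H ez F (x, y, t, z) = 0 := by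
    intro x y t hp z hz
    rw [← h.wx_eq hΩ hp hz, ← h.wy_eq hΩ hp hz, ← h.wz_eq hΩ hH hp hz]
    exact congrFun (h₁ x y t hp z hz) i
  have Q : ∀ x y t, (x, y, t) ∈ Ω → ∀ z ∈ H, pd Ω H et F (x, y, t, z)
      + (1 / 2 * z ^ 2 + u x y t * z) * pd Ω H ex F (x, y, t, z)
      - ((dx u x y t * z + dy u x y t + 2 * u x y t * dx u x y t) * z + E x y t)
        * pd Ω H ez F (x, y, t, z) = 0 := by
    intro x y t hp z hz
    rw [← h.wx_eq hΩ hp hz, ← h.wt_eq hΩ hp hz, ← h.wz_eq hΩ hH hp hz]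
    refine Eq.trans ?_ (congrFun (h₂ x y t hp z hz) i)
    simp only [lax₂, wx, wt, wz, Pi.add_apply, Pi.smul_apply, smul_eq_mul]
    ring
  have sF := fun e => pd_smooth hΩ hH nF.smooth e
  have X := fun e => hasDerivAt_x hΩ (sF e) hp hz
  have Y := fun e => hasDerivAt_y hΩ (sF e) hp hz
  have T := fun e => hasDerivAt_t hΩ (sF e) hp hz
  have Z := fun e => (nF.pd hΩ hH e).hasDerivWithinAt hΩ hH hp hz
  have hux := hu.dx hΩ
  have huy := hu.dy hΩ
  have zx : ∀ {f : ℝ → ℂ} {d : ℂ}, HasDerivAt f d x → (∀ᶠ s in 𝓝 x, f s = 0) → d = 0 :=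
    fun hf h0 => hf.unique ((hasDerivAt_const x (0 : ℂ)).congr_of_eventuallyEq h0)
  have zy : ∀ {f : ℝ → ℂ} {d : ℂ}, HasDerivAt f d y → (∀ᶠ s in 𝓝 y, f s = 0) → d = 0 :=
    fun hf h0 => hf.unique ((hasDerivAt_const y (0 : ℂ)).congr_of_eventuallyEq h0)
  have zt : ∀ {f : ℝ → ℂ} {d : ℂ}, HasDerivAt f d t → (∀ᶠ s in 𝓝 t, f s = 0) → d = 0 :=
    fun hf h0 => hf.unique ((hasDerivAt_const t (0 : ℂ)).congr_of_eventuallyEq h0)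
  have zz : ∀ {f : ℂ → ℂ} {d : ℂ}, HasDerivWithinAt f d H z → (∀ w ∈ H, f w = 0) → d = 0 :=
    fun hf h0 => (hH.uniqueDiffOn z hz).eq_deriv _ hf
      ((hasDerivWithinAt_const z H (0 : ℂ)).congr h0 (h0 z hz))
  have i1 := hasDerivWithinAt_id z H
  have Px := zx (((X ey).sub ((X ex).const_mul z)).add
    ((((hux.hasDerivAt_x hΩ hp).const_mul 2).mul_const z).mul (X ez)))
    ((eventually_x hΩ hp).mono fun s hs => P _ _ _ hs z hz)
  have Pt := zt (((T ey).sub ((T ex).const_mul z)).add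
    ((((hux.hasDerivAt_t hΩ hp).const_mul 2).mul_const z).mul (T ez)))
    ((eventually_t hΩ hp).mono fun s hs => P _ _ _ hs z hz)
  have Pz := zz (((Z ey).sub (i1.mul (Z ex))).add
    ((i1.const_mul (2 * dx u x y t)).mul (Z ez))) (fun w hw => P _ _ _ hp w hw)
  have Qx := zx (((X et).add ((((hu.hasDerivAt_x hΩ hp).mul_const z).const_add
    (1 / 2 * z ^ 2)).mul (X ex))).sub ((((((hux.hasDerivAt_x hΩ hp).mul_const z).add
    (huy.hasDerivAt_x hΩ hp)).add (((hu.hasDerivAt_x hΩ hp).const_mul 2).mul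
    (hux.hasDerivAt_x hΩ hp))).mul_const z).add (hE.hasDerivAt_x hΩ hp) |>.mul (X ez)))
    ((eventually_x hΩ hp).mono fun s hs => Q _ _ _ hs z hz)
  have Qy := zy (((Y et).add ((((hu.hasDerivAt_y hΩ hp).mul_const z).const_add
    (1 / 2 * z ^ 2)).mul (Y ex))).sub ((((((hux.hasDerivAt_y hΩ hp).mul_const z).add
    (huy.hasDerivAt_y hΩ hp)).add (((hu.hasDerivAt_y hΩ hp).const_mul 2).mul
    (hux.hasDerivAt_y hΩ hp))).mul_const z).add (hE.hasDerivAt_y hΩ hp) |>.mul (Y ez)))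
    ((eventually_y hΩ hp).mono fun s hs => Q _ _ _ hs z hz)
  have Qz := zz (((Z et).add ((((i1.pow 2).const_mul (1 / 2)).add
    (i1.const_mul (u x y t))).mul (Z ex))).sub (((((i1.const_mul (dx u x y t)).add_const
    (dy u x y t)).add_const (2 * u x y t * dx u x y t)).mul i1).add_const (E x y t)
    |>.mul (Z ez))) (fun w hw => Q _ _ _ hp w hw)
  have hq : (x, y, t, z) ∈ dom Ω H := ⟨hp, hz⟩
  have c := fun e e' => pd_comm hΩ hH nF.smooth e e' hq
  have sq : dy (dx fun x y t => u x y t ^ 2) x y t =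
      2 * dy u x y t * dx u x y t + 2 * u x y t * dy (dx u) x y t := by
    rw [FieldSmooth.congr_deriv_y (w := fun x y t => 2 * u x y t * dx u x y t) hΩ
      (fun x y t hp => ?_) hp]
    · exact (((hu.hasDerivAt_y hΩ hp).const_mul 2).mul (hux.hasDerivAt_y hΩ hp)).deriv
    · refine ((hu.hasDerivAt_x hΩ hp).pow 2).deriv.trans ?_
      simp
  rw [sq, h.wx_eq hΩ hp hz, h.wz_eq hΩ hH hp hz]
  simp only [c ex ey, c ex et, c ex ez, c ey et, c ey ez, c et ez, hu.dx_dy hΩ hp, id,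
    Pi.mul_apply, Pi.pow_apply, Pi.add_apply] at Px Pt Pz Qx Qy Qz
  -- This is `L₁` applied to the second relation minus `L₂ - E∂_λ` applied to the first; second
  -- derivatives of `π` cancel by symmetry.
  linear_combination Qy - z * Qx + 2 * dx u x y t * z * Qz - Pt
    - (1 / 2 * z ^ 2 + u x y t * z) * Px
    + ((dx u x y t * z + dy u x y t + 2 * u x y t * dx u x y t) * z + E x y t) * Pz

end commutator

end lax

/-! ### The Lax pair and the equation -/

section consequences

variable {Ω : Set (ℝ × ℝ × ℝ)} {R : (Fin 2 → ℂ) → (Fin 2 → ℂ)} {u v : Field} {πp πm : Wave}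
  {x y t : ℝ}

theorem IsSolution.dx_v (h : IsSolution Ω R u v πp πm) (x y t : ℝ) (hp : (x, y, t) ∈ Ω) :
    dx v x y t = u x y t := (h.antiderivative x y t hp).deriv

theorem IsSolution.smooth_u (h : IsSolution Ω R u v πp πm) (hΩ : IsOpen Ω) : FieldSmooth Ω u :=
  ContDiffOn.congr (FieldSmooth.dx hΩ h.smooth_v)
    fun p hp => (h.dx_v p.1 p.2.1 p.2.2 hp).symm

theorem LinearizedUnique.eq_zero (hL : LinearizedUnique Ω R πm) (hp : (x, y, t) ∈ Ω)
    (ψp ψm : ℂ → Fin 2 → ℂ) (h : LinSol R (πm x y t) ψp ψm)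
    (h₁ : Filter.Tendsto ψp (atInf upper) (𝓝 0)) (h₂ : Filter.Tendsto ψm (atInf lower) (𝓝 0)) :
    (∀ z ∈ upper, ψp z = 0) ∧ (∀ z ∈ lower, ψm z = 0) :=
  hL x y t hp ψp ψm h.1 h.2 h.3 h.4 h.5 h₁ h₂

/-- The function `2 u_t + ∂_x⁻¹ u_yy + 2 u u_y`, whose `x`-derivative is twice the left-hand side
of the equation. -/
def residue (u v : Field) : Field := fun x y t =>
  2 * dt u x y t + dy (dy v) x y t + 2 * u x y t * dy u x y t

theorem residue_smooth (hΩ : IsOpen Ω) (hu : FieldSmooth Ω u) (hv : FieldSmooth Ω v) :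
    FieldSmooth Ω (residue u v) :=
  (((FieldSmooth.const 2).mul (hu.dt hΩ)).add ((hv.dy hΩ).dy hΩ)).add
    (((FieldSmooth.const 2).mul hu).mul (hu.dy hΩ))

/-- `L₁` has to be treated before `L₂`, whose asymptotics use `L₁π = 0`. The correction by a
multiple of `π_λ` stays within the linearised problem because `residue` does not depend on `λ`. -/
theorem IsSolution.lax_eq (hsol : IsSolution Ω R u v πp πm) (hΩ : IsOpen Ω)
    (hR : Differentiable ℂ R) (hL : LinearizedUnique Ω R πm) (hp : (x, y, t) ∈ Ω) :
    ((∀ z ∈ upper, lax₁ u upper πp x y t z = 0) ∧ (∀ z ∈ lower, lax₁ u lower πm x y t z = 0)) ∧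
    ((∀ z ∈ upper, lax₂ u upper πp x y t z
        + (-residue u v x y t) • wz upper πp x y t z = 0) ∧
      (∀ z ∈ lower, lax₂ u lower πm x y t z
        + (-residue u v x y t) • wz lower πm x y t z = 0)) := by
  have hu := hsol.smooth_u hΩ
  have hv : FieldSmooth Ω v := hsol.smooth_v
  obtain ⟨gp, ρp, ep⟩ := hsol.plus.exists_expansion hΩ isHalfPlane_upper hu hv
  obtain ⟨gm, ρm, em⟩ := hsol.minus.exists_expansion hΩ isHalfPlane_lower hu hv
  have fp := ep.frame hΩ isHalfPlane_upper hv hp hu hsol.dx_v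
  have fm := em.frame hΩ isHalfPlane_lower hv hp hu hsol.dx_v
  have ha := hsol.linSol_wz hR hΩ hp
  have hb := (hsol.linSol_wx hR hΩ hp).add
    (ha.smul (f := fun _ => -(2 * dx u x y t)) (by fun_prop))
  obtain ⟨_, sp⟩ := ep.small_lax₁ hΩ isHalfPlane_upper hv hu hp hsol.dx_v
  obtain ⟨_, sm⟩ := em.small_lax₁ hΩ isHalfPlane_lower hv hu hp hsol.dx_v
  have h1 := eq_zero_of_small (hL.eq_zero hp) ha hb (hsol.linSol_lax₁ hR hΩ hp) fp fm sp sm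
  refine ⟨h1, ?_⟩
  obtain ⟨_, sp⟩ := ep.small_lax₂ hΩ isHalfPlane_upper hv hu hp h1.1
  obtain ⟨_, sm⟩ := em.small_lax₂ hΩ isHalfPlane_lower hv hu hp h1.2
  exact eq_zero_of_small (hL.eq_zero hp) ha hb ((hsol.linSol_lax₂ hR hΩ hp).add
    (ha.smul (f := fun _ => -residue u v x y t) (by fun_prop))) fp fm sp sm

/-- Take the defect of the commutator identity as `λ → ∞`: the defect of `π_x` tends to `1`, while
that of `π_λ` tends to `0` even after multiplication by `λ`. Only `-E` survives. -/
theorem IsSolution.residue_eq_zero (hsol : IsSolution Ω R u v πp πm) (hΩ : IsOpen Ω)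
    (hR : Differentiable ℂ R) (hL : LinearizedUnique Ω R πm) (hp : (x, y, t) ∈ Ω) :
    residue u v x y t = 0 := by
  have hu := hsol.smooth_u hΩ
  have hv : FieldSmooth Ω v := hsol.smooth_v
  have hH := isHalfPlane_upper
  obtain ⟨g, ρ, e⟩ := hsol.plus.exists_expansion hΩ hH hu hv
  have c := fun z (hz : z ∈ upper) => hsol.plus.commutator hΩ hH hu (residue_smooth hΩ hu hv)
    (fun x y t hp => (hsol.lax_eq hΩ hR hL hp).1.1)
    (fun x y t hp => (hsol.lax_eq hΩ hR hL hp).2.1) hp hz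
  have l := e.tendsto_mul_defect_wz hΩ hH hp
  have := hH.neBot_atInf
  have h1 := (((e.tendsto_defect_wx hΩ hH hp hu).const_mul (-residue u v x y t)).add
    (l.const_mul (dx (residue u v) x y t - (2 * dt (dx u) x y t + dy (dy u) x y t
      + dy (dx fun x y t => u x y t ^ 2) x y t)))).add ((tendsto_zero_of_mul l).const_mul
    (2 * residue u v x y t * dx u x y t - dy (residue u v) x y t))
  have h2 := tendsto_nhds_unique h1 (tendsto_const_nhds (x := (0 : ℂ)) |>.congr' (by
    filter_upwards [eventually_atInf] with z hz
    have c0 := c z hz.1 0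
    have c1 := c z hz.1 1
    simp only [defect]
    linear_combination -c1 + (y - t * πp x y t z 0) * c0))
  linear_combination -h2

/-- With `E = 0` the commutator is twice the left-hand side of the equation times `-λπ_λ`, and the
first component of `π_λ` tends to `1`. -/
theorem IsSolution.solvesAt (hsol : IsSolution Ω R u v πp πm) (hΩ : IsOpen Ω)
    (hR : Differentiable ℂ R) (hL : LinearizedUnique Ω R πm) (hp : (x, y, t) ∈ Ω) :
    SolvesAt u x y t := by
  have hu := hsol.smooth_u hΩ
  have hH := isHalfPlane_upper
  obtain ⟨g, ρ, e⟩ := hsol.plus.exists_expansion hΩ hH hu hsol.smooth_v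
  have c := fun z (hz : z ∈ upper) => hsol.plus.commutator (E := fun _ _ _ => 0) hΩ hH hu
    (FieldSmooth.const 0)
    (fun x y t hp => (hsol.lax_eq hΩ hR hL hp).1.1)
    (fun x y t hp z hz => by
      simpa [hsol.residue_eq_zero hΩ hR hL hp] using (hsol.lax_eq hΩ hR hL hp).2.1 z hz) hp hz 0
  have := hH.neBot_atInf
  have h1 := tendsto_nhds_unique ((e.tendsto_wz_zero hΩ hH hp).const_mul
    (2 * dt (dx u) x y t + dy (dy u) x y t + dy (dx fun x y t => u x y t ^ 2) x y t))
    (tendsto_const_nhds (x := (0 : ℂ)) |>.congr' (by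
    filter_upwards [eventually_atInf] with z hz
    have c0 := c z hz.1
    have d1 : dx (fun _ _ _ => (0 : ℂ)) x y t = 0 := by simp [dx]
    have d2 : dy (fun _ _ _ => (0 : ℂ)) x y t = 0 := by simp [dy]
    rw [d1, d2] at c0
    refine mul_left_cancel₀ hz.2 ?_
    linear_combination c0))
  unfold SolvesAt
  linear_combination 1 / 2 * h1

end consequences

/-! ### Schwarz reflection and reality of `u` -/

section reality

variable {Ω : Set (ℝ × ℝ × ℝ)} {H : Set ℂ} {R : (Fin 2 → ℂ) → (Fin 2 → ℂ)} {u v : Field}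
  {π πp πm : Wave}

/-- Complex conjugation of scalar functions. -/
def conjField (u : Field) : Field := fun x y t => star (u x y t)

/-- Schwarz reflection of vector functions. -/
def conjWave (π : Wave) : Wave := fun x y t z => star (π x y t (star z))

theorem dy_conjField (v : Field) (x y t : ℝ) : dy (conjField v) x y t = star (dy v x y t) :=
  deriv.star (f := fun s => v x s t) (x := y)

theorem contDiff_star : ContDiff ℝ ∞ (star : ℂ → ℂ) := Complex.conjCLE.contDiff

theorem contDiffOn_star_comp {F : ℝ × ℝ × ℝ × ℂ → ℂ} (hF : ContDiffOn ℝ ∞ F (dom Ω H)) :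
    ContDiffOn ℝ ∞ (fun q => star (F (q.1, q.2.1, q.2.2.1, star q.2.2.2)))
      (dom Ω (conjSet H)) := by
  refine contDiff_star.comp_contDiffOn (hF.comp (f := fun q : ℝ × ℝ × ℝ × ℂ =>
    (q.1, q.2.1, q.2.2.1, star q.2.2.2)) ?_ fun q hq => hq)
  have : ContDiff ℝ ∞ (fun q : ℝ × ℝ × ℝ × ℂ => star q.2.2.2) :=
    contDiff_star.comp (contDiff_snd.comp (contDiff_snd.comp contDiff_snd))
  fun_prop

theorem IsBigOInv.conj {r r' : ℝ → ℝ → ℝ → ℂ → ℂ} (h : IsBigOInv Ω H r)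
    (hr : ∀ x y t z, r' x y t z = star (r x y t (star z))) : IsBigOInv Ω (conjSet H) r' := by
  obtain ⟨g, hg, he⟩ := h
  refine ⟨_, contDiffOn_star_comp (H := conjSet H) hg, fun x y t hp z hz h0 => ?_⟩
  rw [hr, he x y t hp (star z) hz (by simpa using h0)]
  simp

theorem tendsto_star_atInf : Filter.Tendsto (star : ℂ → ℂ) (atInf (conjSet H)) (atInf H) := by
  refine Filter.tendsto_inf.2 ⟨?_, ?_⟩
  · refine Filter.Tendsto.mono_left ?_ inf_le_left
    rw [← tendsto_norm_atTop_iff_cobounded]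
    simpa using tendsto_norm_cobounded_atTop (E := ℂ)
  · exact (Filter.tendsto_principal.2 (Filter.mem_principal_self _) :
      Filter.Tendsto star (Filter.principal (conjSet H)) (Filter.principal H)).mono_left inf_le_right

theorem star_mem_interior (hH : IsHalfPlane H) {z : ℂ} (hz : z ∈ interior (conjSet H)) :
    star z ∈ interior H := by
  rcases hH with rfl | rfl
  · rw [conjSet_upper, interior_lower] at hz
    rw [interior_upper]
    simpa using hz
  · rw [conjSet_lower, interior_upper] at hz
    rw [interior_lower]
    simpa using hz

theorem IsNormalized.conj (hH : IsHalfPlane H) (h : IsNormalized Ω H u v π) :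
    IsNormalized Ω (conjSet H) (conjField u) (conjField v) (conjWave π) := by
  refine ⟨fun i => contDiffOn_star_comp (h.smooth i), fun x y t hp i z hz => ?_,
    h.expansion₁.conj fun x y t z => ?_, h.expansion₂.conj fun x y t z => ?_, fun x y t hp => ?_⟩
  · have h1 := (h.holomorphic x y t hp i).differentiableAt
      (isOpen_interior.mem_nhds (star_mem_interior hH hz))
    have h2 : DifferentiableAt ℂ _ (star (star z)) := h1.hasDerivAt.conj_conj.differentiableAt
    rw [star_star] at h2
    exact h2.differentiableWithinAt
  · simp [conjWave, conjField]
  · rw [dy_conjField]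
    simp [conjWave, conjField]
  · have h1 := (Complex.continuous_conj.tendsto _).comp
      ((h.recovery x y t hp).comp tendsto_star_atInf)
    have h2 : (starRingEnd ℂ) 2 = 2 := map_ofNat _ 2
    refine h1.congr fun z => ?_
    simp [conjWave, h2]

/-- Reflection exchanges the half planes, so the jump must be inverted: the condition on `R` at the
conjugate of `π⁻` says that `R` sends the conjugate of `π⁺` to that of `π⁻`. -/
theorem IsSolution.conj (h : IsSolution Ω R u v πp πm) (hR : ∀ ξ, R (star (R (star ξ))) = ξ) :
    IsSolution Ω R (conjField u) (conjField v) (conjWave πm) (conjWave πp) := by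
  refine ⟨contDiff_star.comp_contDiffOn h.smooth_v,
    fun x y t hp => (h.antiderivative x y t hp).star, ?_, ?_, fun x y t hp l => ?_⟩
  · have := h.minus.conj isHalfPlane_lower
    rwa [conjSet_lower] at this
  · have := h.plus.conj isHalfPlane_upper
    rwa [conjSet_upper] at this
  · have := hR (star (πm x y t l))
    rw [star_star, ← h.jump x y t hp l] at this
    have hl : star (l : ℂ) = l := Complex.conj_ofReal l
    simp only [conjWave, hl, this]

/-- Uniqueness concerns only `π^±`, but `π⁺` determines the field as `2u = lim (π₁ - λ)`. -/
theorem IsSolution.real (h : IsSolution Ω R u v πp πm) (hΩ : IsOpen Ω)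
    (hU : SolutionUnique Ω R) (hR : ∀ ξ, R (star (R (star ξ))) = ξ) {x y t : ℝ}
    (hp : (x, y, t) ∈ Ω) : (u x y t).im = 0 := by
  have h' := h.conj hR
  have hH := isHalfPlane_upper
  have e := (hU _ _ _ _ _ _ _ _ h h' x y t hp).1
  have key : ∀ {u v : Field} {πp πm : Wave}, IsSolution Ω R u v πp πm →
      Filter.Tendsto (fun z => πp x y t z 0 - z) (atInf upper) (𝓝 (2 * u x y t)) := by
    intro u v πp πm h
    obtain ⟨g, ρ, e⟩ := h.plus.exists_expansion hΩ hH (h.smooth_u hΩ) h.smooth_v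
    have := (tendsto_inv_atInf.mul (tendsto_slice hH e.nice_g.smooth hp)).const_add (2 * u x y t)
    rw [zero_mul, add_zero] at this
    refine this.congr' ?_
    filter_upwards [eventually_atInf] with z hz
    rw [e.eq_zero x y t hp z hz.1 hz.2]
    ring
  have := hH.neBot_atInf
  have h2 := tendsto_nhds_unique (key h) ((key h').congr' (by
    filter_upwards [eventually_atInf] with z hz
    rw [e z hz.1]))
  have h3 : u x y t = star (u x y t) := mul_left_cancel₀ two_ne_zero h2
  exact Complex.conj_eq_iff_im.1 h3.symm

end reality

end NRH

end

theorem mainTheorem4 (Ω : Set (ℝ × ℝ × ℝ)) (hΩ : IsOpen Ω)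
    (R : (Fin 2 → ℂ) → (Fin 2 → ℂ)) (hR : Differentiable ℂ R)
    (u v : NRH.Field) (πp πm : NRH.Wave) (hsol : NRH.IsSolution Ω R u v πp πm) :
    (∀ x y t, (x, y, t) ∈ Ω → ∀ l : ℝ,
      NRH.lax₁ u NRH.upper πp x y t l
        = NRH.jacobian R (πm x y t l) *ᵥ NRH.lax₁ u NRH.lower πm x y t l ∧
      NRH.lax₂ u NRH.upper πp x y t l
        = NRH.jacobian R (πm x y t l) *ᵥ NRH.lax₂ u NRH.lower πm x y t l) ∧
    (NRH.LinearizedUnique Ω R πm → ∀ x y t, (x, y, t) ∈ Ω →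
      (∀ z ∈ NRH.upper,
        NRH.lax₁ u NRH.upper πp x y t z = 0 ∧ NRH.lax₂ u NRH.upper πp x y t z = 0) ∧
      (∀ z ∈ NRH.lower,
        NRH.lax₁ u NRH.lower πm x y t z = 0 ∧ NRH.lax₂ u NRH.lower πm x y t z = 0) ∧
      NRH.SolvesAt u x y t) ∧
    (NRH.SolutionUnique Ω R → (∀ ξ, R (star (R (star ξ))) = ξ) →
      ∀ x y t, (x, y, t) ∈ Ω → (u x y t).im = 0) := by
  refine ⟨fun x y t hp l => ⟨(hsol.linSol_lax₁ hR hΩ hp).jump l, (hsol.linSol_lax₂ hR hΩ hp).jump l⟩,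
    fun hL x y t hp => ?_, fun hU hC x y t hp => hsol.real hΩ hU hC hp⟩
  obtain ⟨⟨h1, h2⟩, h3, h4⟩ := hsol.lax_eq hΩ hR hL hp
  rw [hsol.residue_eq_zero hΩ hR hL hp] at h3 h4
  simp only [neg_zero, zero_smul, add_zero] at h3 h4
  exact ⟨fun z hz => ⟨h1 z hz, h3 z hz⟩, fun z hz => ⟨h2 z hz, h4 z hz⟩,
    hsol.solvesAt hΩ hR hL hp⟩
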